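/- **Theorem (Rényi operator-space entanglement of the translation-symmetric maximally mixed state).** Fix integers $d\ge 2$ and $k\ge 2$. For $L\ge 1$ consider a ring of $L$ qudits of dimension $d$, with Hilbert space $(\mathbb C^d)^{\otimes L}$, and let $T$ be the translation by one site. Let $P=\frac1L\sum_{n=0}^{L-1}T^n$ be the projector onto the translation-invariant subspace and $\rho_{\mathcal T}=P/\operatorname{Tr}P$. Let $$|\rho_{\mathcal T}\rangle\rangle\ \propto\ \sum_{\sigma\in\{0,\dots,d-1\}^L}(\rho_{\mathcal T}\otimes \mathbb 1)\,|\sigma\rangle|\sigma\rangle$$ be its vectorization in the doubled space, normalized to a unit vector. For an interval $A$ of consecutive sites of the ring, let $R_A$ be the reduced density matrix of $|\rho_{\mathcal T}\rangle\rangle\langle\langle\rho_{\mathcal T}|$ on $A\cup\overline A$ (the sites of $A$ in both copies), and let $S_k(R_A)=\frac1{1-k}\log\operatorname{Tr}R_A^k$ be the Rényi-$k$ operator-space entanglement. Put $$s_k(L)=\frac{k}{k-1}\log L-\frac1{k-1}\log\left(\frac{1+d^{-2(k-1)}}{1-d^{-2(k-1)}}\right),$$ which does not depend on $A$. 1. There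 is a constant $C=C(d,k)$ such that for every $L\ge1$ and every interval $A$ with $|A|\le L/2$, $$\bigl|S_k(R_A)-s_k(L)\bigr|\ \le\ C\,L^{2k}\left(d^{-2|A|}+d^{-L/2}\right).$$ 2. Consequently, for $\log L\ll|A|\le L/2$, the correction is exponentially small in $|A|$: for every $c<1$ there are constants $K,C$, depending only on $d,k,c$, such that for every $L\ge1$ and every interval $A$ with $K\log L\le |A|\le L/2$, $$\bigl|S_k(R_A)-s_k(L)\bigr|\ \le\ C\,d^{-c|A|}.$$ -/

import Mathlib

/-- Computational-basis labels of a ring of `L` qudits of local dimension `d`.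
The sites are the elements of `ZMod L`, so that site arithmetic is periodic. -/
abbrev RingConfig (L d : ℕ) : Type := ZMod L → Fin d

/-- The translation operator `T` by one site: `T` sends the basis state `|σ⟩` to `|τ⟩` with
`τ (i + 1) = σ i`. -/
def translationOp (L d : ℕ) [NeZero L] : Matrix (RingConfig L d) (RingConfig L d) ℂ :=
  Matrix.of fun τ σ => if (∀ i : ZMod L, τ (i + 1) = σ i) then 1 else 0

/-- The projector `P = (1/L) (1 + T + ⋯ + T^(L-1))` onto the zero-momentum subspace. -/
noncomputable def translationProjector (L d : ℕ) [NeZero L] :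
    Matrix (RingConfig L d) (RingConfig L d) ℂ :=
  (L : ℂ)⁻¹ • ∑ n ∈ Finset.range L, translationOp L d ^ n

/-- The maximally mixed invariant state of strong translation symmetry, `P / Tr P`. -/
noncomputable def translationMMIS (L d : ℕ) [NeZero L] :
    Matrix (RingConfig L d) (RingConfig L d) ℂ :=
  (translationProjector L d).trace⁻¹ • translationProjector L d

/-- The vectorization `∑_σ (M ⊗ 1) |σ⟩|σ⟩` of an operator `M`, written in the computational basis
`|τ⟩|σ⟩` of the doubled space, and normalized to a unit vector. -/
noncomputable def doubledState {ι : Type*} [Fintype ι] (M : Matrix ι ι ℂ) : ι × ι → ℂ :=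
  fun x => M x.1 x.2 / (Real.sqrt (∑ y : ι × ι, ‖M y.1 y.2‖ ^ 2) : ℂ)

/-- The configuration that equals `α` on `A` and `γ` on the complement of `A`. -/
def glueConfig {L d : ℕ} (A : Finset (ZMod L)) (α : {i // i ∈ A} → Fin d)
    (γ : {i // i ∉ A} → Fin d) : RingConfig L d :=
  fun i => if h : i ∈ A then α ⟨i, h⟩ else γ ⟨i, h⟩

/-- Basis labels of the doubled subsystem `A ∪ Ā`: the region `A` of the ket copy together with the
same region of the bra copy. -/
abbrev DoubledRegionConfig {L : ℕ} (d : ℕ) (A : Finset (ZMod L)) : Type :=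
  ({i // i ∈ A} → Fin d) × ({i // i ∈ A} → Fin d)

/-- The partial trace, over the complement of `A` in both copies, of an operator on the doubled
space. -/
def partialTraceDoubled {L d : ℕ} [NeZero L] (A : Finset (ZMod L))
    (M : Matrix (RingConfig L d × RingConfig L d) (RingConfig L d × RingConfig L d) ℂ) :
    Matrix (DoubledRegionConfig d A) (DoubledRegionConfig d A) ℂ :=
  Matrix.of fun x y =>
    ∑ γ : {i // i ∉ A} → Fin d, ∑ δ : {i // i ∉ A} → Fin d,
      M (glueConfig A x.1 γ, glueConfig A x.2 δ) (glueConfig A y.1 γ, glueConfig A y.2 δ)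

/-- The reduced density matrix on `A ∪ Ā` of the normalized doubled state of an operator `ρ`. -/
noncomputable def doubledReducedDensity {L d : ℕ} [NeZero L] (A : Finset (ZMod L))
    (ρ : Matrix (RingConfig L d) (RingConfig L d) ℂ) :
    Matrix (DoubledRegionConfig d A) (DoubledRegionConfig d A) ℂ :=
  partialTraceDoubled A (Matrix.vecMulVec (doubledState ρ) (star (doubledState ρ)))

/-- The Rényi-`k` entropy `(1 / (1 - k)) log Tr R^k` of a density matrix (natural logarithm). -/
noncomputable def renyiEntropy {ι : Type*} [Fintype ι] [DecidableEq ι] (k : ℕ)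
    (R : Matrix ι ι ℂ) : ℝ :=
  (1 / (1 - (k : ℝ))) * Real.log (R ^ k).trace.re

/-- The Rényi-`k` operator-space entanglement of `ρ` for the region `A`. -/
noncomputable def renyiOSE {L d : ℕ} [NeZero L] (k : ℕ) (A : Finset (ZMod L))
    (ρ : Matrix (RingConfig L d) (RingConfig L d) ℂ) : ℝ :=
  renyiEntropy k (doubledReducedDensity A ρ)

/-- `A` is an interval `{s, s + 1, …, s + a - 1}` of consecutive sites of the ring. -/
def IsRingInterval {L : ℕ} (A : Finset (ZMod L)) : Prop :=
  ∃ (s : ZMod L) (a : ℕ), A = (Finset.range a).image fun j : ℕ => s + (j : ZMod L)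

/-!
Cut along `A ∪ Ā`, the vectorized translations of the ring become matrices `v₀, …, v_{L-1}`, which
we normalize to Frobenius norm one, and `R_A` is proportional to `W Wᵀ` with `W = ∑ vₙ`. Each
`vₙ` is a multiple of a partial isometry: `vₙ vₙᵀ vₙ = d^(-c) vₙ`, where `c = 2 min(n, L - n, |A|)`
counts the sites that the translation by `n` carries across the boundary of `A`. Hence
`Tr (vₙ vₙᵀ)^k = d^(-2(k-1) min(n, L - n, |A|))`, and the sum over `n` is, up to errors of order
`L d^(-2(k-1)|A|)`, the two-sided geometric series `(1 + x) / (1 - x)` with `x = d^(-2(k-1))`.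

The remaining terms of `Tr (W Wᵀ)^k` are traces of words in which two different translations are
adjacent at least twice around the cycle, so that Cauchy–Schwarz bounds them by the products
`vₙᵀ vₘ` and `vₙ vₘᵀ` with `n ≠ m`. Here configurations are constrained along the orbits of
the translation by `m - n` that stay inside one side of the cut. No such orbit stays inside `A`,
since the interval `A` is at most half of the ring, and on the other side half of the sites suffice
to meet all of them.
-/

open scoped Matrix

section FrobeniusNorm

variable {m n : Type*} [Fintype m] [Fintype n]

/-- The squared Frobenius norm of a real matrix. Working with the square keeps the bounds below,
which come from counting configurations, free of square roots. -/
def frobSq (X : Matrix m n ℝ) : ℝ :=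
  ∑ i, ∑ j, X i j ^ 2

theorem frobSq_nonneg (X : Matrix m n ℝ) : 0 ≤ frobSq X :=
  Finset.sum_nonneg fun _ _ => Finset.sum_nonneg fun _ _ => sq_nonneg _

theorem frobSq_smul (c : ℝ) (X : Matrix m n ℝ) : frobSq (c • X) = c ^ 2 * frobSq X := by
  simp only [frobSq, Matrix.smul_apply, smul_eq_mul, mul_pow, Finset.mul_sum]

theorem frobSq_transpose (X : Matrix m n ℝ) : frobSq Xᵀ = frobSq X :=
  Finset.sum_comm

theorem trace_transpose_mul_self (X : Matrix m n ℝ) : (Xᵀ * X).trace = frobSq X := by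
  rw [← frobSq_transpose X]
  simp only [frobSq, Matrix.trace, Matrix.diag, Matrix.mul_apply, Matrix.transpose_apply, sq]

theorem sq_trace_mul_le (X : Matrix m n ℝ) (Y : Matrix n m ℝ) :
    (X * Y).trace ^ 2 ≤ frobSq X * frobSq Y := by
  rw [← frobSq_transpose Y]
  simpa only [Fintype.sum_prod_type, frobSq, Matrix.trace, Matrix.diag, Matrix.mul_apply,
    Matrix.transpose_apply] using
    Finset.sum_mul_sq_le_sq_mul_sq (Finset.univ : Finset (m × n))
      (fun p => X p.1 p.2) (fun p => Y p.2 p.1)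

/-- `K` does not increase the Frobenius norm when multiplied from the left, that is, its operator
norm is at most one. -/
def IsFrobContraction (K : Matrix n n ℝ) : Prop :=
  ∀ X : Matrix n n ℝ, frobSq (K * X) ≤ frobSq X

theorem IsFrobContraction.list_prod [DecidableEq n] {l : List (Matrix n n ℝ)}
    (hl : ∀ K ∈ l, IsFrobContraction K) : IsFrobContraction l.prod :=
  l.prod_induction IsFrobContraction
    (fun K K' hK hK' X => by simpa only [Matrix.mul_assoc] using (hK _).trans (hK' X))
    (fun X => by rw [Matrix.one_mul]) hl

theorem abs_trace_mul_mul_mul_le {δ : ℝ} {X Y K₁ K₂ : Matrix n n ℝ}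
    (hK₁ : IsFrobContraction K₁) (hK₂ : IsFrobContraction K₂)
    (hX : frobSq X ≤ δ) (hY : frobSq Y ≤ δ) : |(X * K₁ * (Y * K₂)).trace| ≤ δ := by
  have hδ : 0 ≤ δ := (frobSq_nonneg X).trans hX
  have hcyc : (X * K₁ * (Y * K₂)).trace = ((K₂ * X) * (K₁ * Y)).trace := by
    rw [← Matrix.mul_assoc, Matrix.trace_mul_comm]
    simp only [Matrix.mul_assoc]
  refine abs_le_of_sq_le_sq ?_ hδ
  calc (X * K₁ * (Y * K₂)).trace ^ 2 ≤ frobSq (K₂ * X) * frobSq (K₁ * Y) :=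
        hcyc ▸ sq_trace_mul_le _ _
    _ ≤ δ ^ 2 := by
        rw [sq]
        exact mul_le_mul ((hK₂ X).trans hX) ((hK₁ Y).trans hY) (frobSq_nonneg _) hδ

theorem isFrobContraction_of_pow_three_eq_smul [DecidableEq n] {H : Matrix n n ℝ} {c : ℝ}
    (hsymm : Hᵀ = H) (hc : c ≤ 1) (hH : H ^ 3 = c • H) : IsFrobContraction H := by
  intro X
  have hfour : H * (H * (H * H)) = c • (H * H) := by
    rw [← Matrix.mul_smul, ← hH]
    noncomm_ring
  have hinner : (Xᵀ * (H * (H * X))).trace = frobSq (H * X) := by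
    rw [← trace_transpose_mul_self, Matrix.transpose_mul, hsymm, Matrix.mul_assoc]
  have hsquare : frobSq (H * (H * X)) = c * frobSq (H * X) := by
    calc frobSq (H * (H * X)) = (Xᵀ * (H * (H * (H * H)) * X)).trace := by
          rw [← trace_transpose_mul_self]
          simp only [Matrix.transpose_mul, hsymm, Matrix.mul_assoc]
      _ = c * frobSq (H * X) := by
          rw [hfour, ← hinner, Matrix.smul_mul, Matrix.mul_smul, Matrix.trace_smul, smul_eq_mul,
            Matrix.mul_assoc]
  -- Cauchy–Schwarz for `⟨X, H² X⟩ = ‖H X‖²`, combined with `‖H² X‖² = c ‖H X‖²`.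
  have hcs : frobSq (H * X) ^ 2 ≤ frobSq X * (c * frobSq (H * X)) := by
    simpa only [hinner, hsquare, frobSq_transpose] using sq_trace_mul_le Xᵀ (H * (H * X))
  rcases (frobSq_nonneg (H * X)).eq_or_lt with h0 | hpos
  · exact h0 ▸ frobSq_nonneg X
  · have hle : frobSq (H * X) ≤ c * frobSq X := le_of_mul_le_mul_right (by linarith) hpos
    exact hle.trans (mul_le_of_le_one_left (frobSq_nonneg X) hc)

end FrobeniusNorm

section Words

variable {ι : Type*}

theorem eq_replicate_or_exists_adjacent_ne [Nonempty ι] (l : List ι) :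
    (∃ p, l = List.replicate l.length p) ∨ ∃ l₁ a b l₂, l = l₁ ++ a :: b :: l₂ ∧ a ≠ b := by
  by_cases h : l.IsChain (· = ·)
  · left
    rcases l with _ | ⟨a, l⟩
    · exact ⟨Classical.arbitrary ι, rfl⟩
    · exact ⟨a, List.isChain_eq_iff_eq_replicate.1 h a rfl⟩
  · right
    rw [List.isChain_iff_forall_rel_of_append_cons_cons] at h
    push Not at h
    obtain ⟨a, b, l₁, l₂, hl, hab⟩ := h
    exact ⟨l₁, a, b, l₂, hl, hab⟩

/-- A nonconstant cyclic word changes letter at least twice, and two changes that are not at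
disjoint positions surround a single letter. -/
theorem exists_isRotated_of_forall_ne_replicate {l : List ι} (hlen : 4 ≤ l.length)
    (hl : ∀ p, l ≠ List.replicate l.length p) :
    (∃ z p, z ≠ p ∧ l ~r z :: List.replicate (l.length - 1) p) ∨
      ∃ z a b c l₁ l₂, z ≠ a ∧ b ≠ c ∧ l ~r z :: a :: (l₁ ++ b :: c :: l₂) := by
  have : Nonempty ι := ⟨l.head (List.ne_nil_of_length_pos (by omega))⟩
  rcases eq_replicate_or_exists_adjacent_ne l with ⟨p, hp⟩ | ⟨l₁, z, a, l₂, rfl, hza⟩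
  · exact absurd hp (hl p)
  have hrot : l₁ ++ z :: a :: l₂ ~r z :: a :: (l₂ ++ l₁) := List.isRotated_append
  have hrest : (l₁ ++ z :: a :: l₂).length = (l₂ ++ l₁).length + 2 := by
    simp only [List.length_append, List.length_cons]
    omega
  rw [hrest] at hlen ⊢
  generalize l₂ ++ l₁ = w at hrot hlen
  have hrot' : l₁ ++ z :: a :: l₂ ~r a :: (w ++ [z]) := hrot.trans ⟨1, by simp⟩
  rcases eq_replicate_or_exists_adjacent_ne w with ⟨p, hp⟩ | ⟨w₁, b, c, w₂, rfl, hbc⟩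
  · obtain ⟨r, hr⟩ : ∃ r, w.length = r + 2 := ⟨w.length - 2, by omega⟩
    rw [hr] at hp ⊢
    subst hp
    rcases eq_or_ne a p with rfl | hap
    · exact Or.inl ⟨z, a, hza, hrot⟩
    rcases eq_or_ne p z with rfl | hpz
    · refine Or.inl ⟨a, p, hap, ?_⟩
      rwa [← List.replicate_succ'] at hrot'
    · refine Or.inr ⟨a, p, p, z, List.replicate r p, [], hap, hpz, ?_⟩
      rwa [List.replicate_succ, List.replicate_succ', List.cons_append, List.append_assoc] at hrot'
  · exact Or.inr ⟨z, a, b, c, w₁, w₂, hza, hbc, hrot⟩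

variable {n : Type*} [Fintype n] [DecidableEq n]

theorem trace_list_prod_eq_of_isRotated {l l' : List (Matrix n n ℝ)} (h : l ~r l') :
    l.prod.trace = l'.prod.trace := by
  obtain ⟨k, rfl⟩ := h
  rw [List.rotate_eq_drop_append_take_mod, List.prod_append, Matrix.trace_mul_comm,
    ← List.prod_append, List.take_append_drop]

theorem abs_trace_word_le {H : ι → Matrix n n ℝ} {δ : ℝ} {l : List ι} (hlen : 4 ≤ l.length)
    (hl : ∀ p, l ≠ List.replicate l.length p) (hcontr : ∀ i, IsFrobContraction (H i))
    (hpair : ∀ i j, i ≠ j → frobSq (H i * H j) ≤ δ)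
    (hsingle : ∀ i j, i ≠ j → |(H i * H j ^ (l.length - 1)).trace| ≤ δ) :
    |(l.map H).prod.trace| ≤ δ := by
  rcases exists_isRotated_of_forall_ne_replicate hlen hl with
    ⟨z, p, hzp, hrot⟩ | ⟨z, a, b, c, l₁, l₂, hza, hbc, hrot⟩
  · rw [trace_list_prod_eq_of_isRotated (hrot.map H), List.map_cons, List.map_replicate,
      List.prod_cons, List.prod_replicate]
    exact hsingle z p hzp
  · have hprod (w : List ι) : IsFrobContraction (w.map H).prod :=
      IsFrobContraction.list_prod (by simpa using fun i _ => hcontr i)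
    rw [trace_list_prod_eq_of_isRotated (hrot.map H)]
    simpa only [List.map_cons, List.map_append, List.prod_cons, List.prod_append,
      Matrix.mul_assoc] using
      abs_trace_mul_mul_mul_le (hprod l₁) (hprod l₂) (hpair z a hza) (hpair b c hbc)

theorem sum_pow_eq_sum_prod_ofFn [Fintype ι] {R : Type*} [Semiring R] (H : ι → R) (q : ℕ) :
    (∑ i, H i) ^ q = ∑ f : Fin q → ι, ((List.ofFn f).map H).prod := by
  simpa only [MultilinearMap.mkPiAlgebraFin_apply, List.ofFn_const, List.prod_replicate,
    List.map_ofFn, Function.comp_def] using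
    (MultilinearMap.mkPiAlgebraFin ℕ q R).map_sum fun _ => H

variable [Fintype ι]

/-- The words of length `q` with at least two different letters. -/
def nonconstantWords (ι : Type*) [Fintype ι] [DecidableEq ι] (q : ℕ) : Finset (Fin q → ι) :=
  (Finset.univ.image fun (i : ι) (_ : Fin q) => i)ᶜ

theorem trace_sum_pow_eq [DecidableEq ι] {q : ℕ} (hq : q ≠ 0) (H : ι → Matrix n n ℝ) :
    ((∑ i, H i) ^ q).trace = ∑ i, (H i ^ q).trace +
      ∑ f ∈ nonconstantWords ι q, ((List.ofFn f).map H).prod.trace := by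
  have : NeZero q := ⟨hq⟩
  have hconst : ∑ f ∈ Finset.univ.image (fun (i : ι) (_ : Fin q) => i),
      ((List.ofFn f).map H).prod.trace = ∑ i, (H i ^ q).trace := by
    rw [Finset.sum_image fun i _ j _ h => congrFun h 0]
    simp only [List.ofFn_const, List.map_replicate, List.prod_replicate]
  rw [sum_pow_eq_sum_prod_ofFn, Matrix.trace_sum, ← hconst, nonconstantWords,
    Finset.sum_add_sum_compl]

theorem sum_trace_pow_le_trace_sum_pow {q : ℕ} (hq : q ≠ 0) {H : ι → Matrix n n ℝ}
    (hH : ∀ i x y, 0 ≤ H i x y) : ∑ i, (H i ^ q).trace ≤ ((∑ i, H i) ^ q).trace := by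
  classical
  have hword (l : List ι) : ∀ x y, 0 ≤ (l.map H).prod x y := by
    refine List.prod_induction (fun K : Matrix n n ℝ => ∀ x y, 0 ≤ K x y) ?_ ?_ ?_
    · intro K K' hK hK' x y
      rw [Matrix.mul_apply]
      exact Finset.sum_nonneg fun z _ => mul_nonneg (hK x z) (hK' z y)
    · intro x y
      rw [Matrix.one_apply]
      positivity
    · simpa using fun i _ => hH i
  rw [trace_sum_pow_eq hq]
  exact le_add_of_nonneg_right
    (Finset.sum_nonneg fun f _ => Finset.sum_nonneg fun x _ => hword _ x x)

theorem abs_trace_sum_pow_sub_le {H : ι → Matrix n n ℝ} {δ : ℝ} {q : ℕ} (hq : 4 ≤ q)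
    (hδ : 0 ≤ δ) (hcontr : ∀ i, IsFrobContraction (H i))
    (hpair : ∀ i j, i ≠ j → frobSq (H i * H j) ≤ δ)
    (hsingle : ∀ i j, i ≠ j → |(H i * H j ^ (q - 1)).trace| ≤ δ) :
    |((∑ i, H i) ^ q).trace - ∑ i, (H i ^ q).trace| ≤ (Fintype.card ι : ℝ) ^ q * δ := by
  classical
  have hword : ∀ f ∈ nonconstantWords ι q, |((List.ofFn f).map H).prod.trace| ≤ δ := by
    intro f hf
    refine abs_trace_word_le (by simpa using hq) (fun p hp => ?_) hcontr hpair
      (by simpa using hsingle)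
    rw [List.length_ofFn, ← List.ofFn_const] at hp
    simp only [nonconstantWords, Finset.mem_compl, Finset.mem_image, Finset.mem_univ, true_and,
      not_exists] at hf
    exact hf p (List.ofFn_injective hp).symm
  rw [trace_sum_pow_eq (by omega), add_sub_cancel_left]
  calc |∑ f ∈ nonconstantWords ι q, ((List.ofFn f).map H).prod.trace|
      ≤ ∑ f ∈ nonconstantWords ι q, |((List.ofFn f).map H).prod.trace| :=
        Finset.abs_sum_le_sum_abs _ _
    _ ≤ (nonconstantWords ι q).card * δ := by
        rw [← nsmul_eq_mul]
        exact Finset.sum_le_card_nsmul _ _ δ hword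
    _ ≤ (Fintype.card (Fin q → ι) : ℝ) * δ := by
        gcongr
        exact Finset.card_le_univ _
    _ = (Fintype.card ι : ℝ) ^ q * δ := by simp

end Words

section SymmetricBlocks

variable {m n : Type*}

/-- The symmetric matrix with off-diagonal blocks `v` and `vᵀ`. It turns a product
`v₁ v₂ᵀ v₃ v₄ᵀ ⋯` of alternating factors into a product of square matrices. -/
def symBlock (v : Matrix m n ℝ) : Matrix (m ⊕ n) (m ⊕ n) ℝ :=
  Matrix.fromBlocks 0 v vᵀ 0

theorem transpose_symBlock (v : Matrix m n ℝ) : (symBlock v)ᵀ = symBlock v := by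
  simp [symBlock, Matrix.fromBlocks_transpose]

theorem symBlock_nonneg {v : Matrix m n ℝ} (hv : ∀ x y, 0 ≤ v x y) (x y : m ⊕ n) :
    0 ≤ symBlock v x y := by
  rcases x with x | x <;> rcases y with y | y <;> simp [symBlock, hv]

theorem symBlock_sum {ι : Type*} (s : Finset ι) (v : ι → Matrix m n ℝ) :
    symBlock (∑ i ∈ s, v i) = ∑ i ∈ s, symBlock (v i) := by
  ext (x | x) (y | y) <;> simp [symBlock, Matrix.sum_apply]

variable [Fintype m] [Fintype n]

theorem symBlock_mul_symBlock (v w : Matrix m n ℝ) :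
    symBlock v * symBlock w = Matrix.fromBlocks (v * wᵀ) 0 0 (vᵀ * w) := by
  simp [symBlock, Matrix.fromBlocks_multiply]

theorem trace_fromBlocks_eq_add (A : Matrix m m ℝ) (B : Matrix m n ℝ) (C : Matrix n m ℝ)
    (D : Matrix n n ℝ) : (Matrix.fromBlocks A B C D).trace = A.trace + D.trace := by
  simp [Matrix.trace, Fintype.sum_sum_type]

theorem frobSq_symBlock_mul_symBlock (v w : Matrix m n ℝ) :
    frobSq (symBlock v * symBlock w) = frobSq (v * wᵀ) + frobSq (vᵀ * w) := by
  simp [symBlock_mul_symBlock, frobSq, Fintype.sum_sum_type]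

theorem trace_symBlock_mul_symBlock (v w : Matrix m n ℝ) :
    (symBlock v * symBlock w).trace = 2 * (v * wᵀ).trace := by
  rw [symBlock_mul_symBlock, trace_fromBlocks_eq_add, ← Matrix.trace_transpose (vᵀ * w),
    Matrix.transpose_mul, Matrix.transpose_transpose, Matrix.trace_mul_comm wᵀ, two_mul]

variable [DecidableEq m]

theorem trace_mul_pow_comm [DecidableEq n] {k : ℕ} (hk : k ≠ 0) (v : Matrix m n ℝ)
    (w : Matrix n m ℝ) : ((w * v) ^ k).trace = ((v * w) ^ k).trace := by
  obtain ⟨k, rfl⟩ := Nat.exists_eq_succ_of_ne_zero hk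
  have hshift (k : ℕ) : v * (w * v) ^ k = (v * w) ^ k * v := by
    induction k with
    | zero => simp
    | succ k ih =>
      rw [pow_succ, ← Matrix.mul_assoc, ih, pow_succ]
      simp only [Matrix.mul_assoc]
  rw [pow_succ', Matrix.mul_assoc, Matrix.trace_mul_comm, hshift, Matrix.mul_assoc, ← pow_succ]

theorem trace_symBlock_pow_two_mul [DecidableEq n] {k : ℕ} (hk : k ≠ 0) (v : Matrix m n ℝ) :
    (symBlock v ^ (2 * k)).trace = 2 * ((v * vᵀ) ^ k).trace := by
  rw [pow_mul, sq, symBlock_mul_symBlock, Matrix.fromBlocks_diagonal_pow, trace_fromBlocks_eq_add,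
    trace_mul_pow_comm hk, two_mul]

theorem symBlock_pow_three [DecidableEq n] {v : Matrix m n ℝ} {c : ℝ} (hv : v * vᵀ * v = c • v) :
    symBlock v ^ 3 = c • symBlock v := by
  have hv' : vᵀ * v * vᵀ = c • vᵀ := by
    rw [← Matrix.transpose_smul, ← hv]
    simp [Matrix.transpose_mul, Matrix.mul_assoc]
  rw [pow_succ, sq, symBlock_mul_symBlock]
  simp [symBlock, Matrix.fromBlocks_multiply, Matrix.fromBlocks_smul, hv, hv']

theorem pow_two_mul_add_one_of_pow_three {R A : Type*} [CommSemiring R] [Semiring A] [Algebra R A]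
    {H : A} {c : R} (hH : H ^ 3 = c • H) (j : ℕ) : H ^ (2 * j + 1) = c ^ j • H := by
  induction j with
  | zero => simp
  | succ j ih =>
    rw [show 2 * (j + 1) + 1 = (2 * j + 1) + 2 by ring, pow_add, ih, smul_mul_assoc, ← pow_succ',
      hH, smul_smul, pow_succ]

variable {ι : Type*} {v : ι → Matrix m n ℝ} {c : ι → ℝ} {k : ℕ}

theorem trace_symBlock_pow_of_partialIsometry [DecidableEq n] {v : Matrix m n ℝ} {c : ℝ}
    (hv : v * vᵀ * v = c • v) (htr : (v * vᵀ).trace = 1) (hk : k ≠ 0) :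
    (symBlock v ^ (2 * k)).trace = 2 * c ^ (k - 1) := by
  obtain ⟨k, rfl⟩ := Nat.exists_eq_succ_of_ne_zero hk
  rw [show 2 * (k + 1) = (2 * k + 1) + 1 by ring, pow_succ,
    pow_two_mul_add_one_of_pow_three (symBlock_pow_three hv), Matrix.smul_mul, Matrix.trace_smul,
    trace_symBlock_mul_symBlock, htr, smul_eq_mul, Nat.succ_sub_one]
  ring

theorem sum_pow_le_trace_sum_mul_transpose_pow [Fintype ι]
    (hv : ∀ i, v i * (v i)ᵀ * v i = c i • v i) (htr : ∀ i, (v i * (v i)ᵀ).trace = 1)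
    (hnonneg : ∀ i x y, 0 ≤ v i x y) (hk : k ≠ 0) :
    ∑ i, c i ^ (k - 1) ≤ (((∑ i, v i) * (∑ i, v i)ᵀ) ^ k).trace := by
  classical
  have h := sum_trace_pow_le_trace_sum_pow (q := 2 * k) (by omega)
    fun i => symBlock_nonneg (hnonneg i)
  rw [← symBlock_sum, trace_symBlock_pow_two_mul hk] at h
  simp only [trace_symBlock_pow_of_partialIsometry (hv _) (htr _) hk, ← Finset.mul_sum] at h
  exact le_of_mul_le_mul_left h two_pos

theorem abs_trace_sum_mul_transpose_pow_sub_le [Fintype ι] {ε : ℝ}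
    (hv : ∀ i, v i * (v i)ᵀ * v i = c i • v i) (htr : ∀ i, (v i * (v i)ᵀ).trace = 1)
    (hc0 : ∀ i, 0 ≤ c i) (hc1 : ∀ i, c i ≤ 1) (hk : 2 ≤ k) (hε : 0 ≤ ε)
    (hfrob : ∀ i j, i ≠ j → frobSq (v i * (v j)ᵀ) + frobSq ((v i)ᵀ * v j) ≤ 2 * ε)
    (htrace : ∀ i j, i ≠ j → |(v i * (v j)ᵀ).trace| ≤ ε) :
    |(((∑ i, v i) * (∑ i, v i)ᵀ) ^ k).trace - ∑ i, c i ^ (k - 1)| ≤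
      (Fintype.card ι : ℝ) ^ (2 * k) * ε := by
  classical
  have hsingle : ∀ i j, i ≠ j →
      |(symBlock (v i) * symBlock (v j) ^ (2 * k - 1)).trace| ≤ 2 * ε := by
    intro i j hij
    rw [show 2 * k - 1 = 2 * (k - 1) + 1 by omega,
      pow_two_mul_add_one_of_pow_three (symBlock_pow_three (hv j)), Matrix.mul_smul,
      Matrix.trace_smul, trace_symBlock_mul_symBlock, smul_eq_mul, abs_mul, abs_mul, abs_two,
      abs_of_nonneg (pow_nonneg (hc0 j) _)]
    exact (mul_le_of_le_one_left (by positivity) (pow_le_one₀ (hc0 j) (hc1 j))).trans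
      (by linarith [htrace i j hij])
  have h := abs_trace_sum_pow_sub_le (q := 2 * k) (δ := 2 * ε) (by omega) (by positivity)
    (fun i => isFrobContraction_of_pow_three_eq_smul (transpose_symBlock (v i)) (hc1 i)
      (symBlock_pow_three (hv i)))
    (fun i j hij => (frobSq_symBlock_mul_symBlock _ _).trans_le (hfrob i j hij)) hsingle
  rw [← symBlock_sum, trace_symBlock_pow_two_mul (by omega)] at h
  simp only [trace_symBlock_pow_of_partialIsometry (hv _) (htr _) (show k ≠ 0 by omega),
    ← Finset.mul_sum, ← mul_sub, abs_mul, abs_two] at h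
  linarith

end SymmetricBlocks

section Orbits

variable {G S : Type*} [AddCommGroup G]

/-- `C` meets every orbit of the translation by `t` that stays inside `X`. -/
def MeetsOrbits (t : G) (X C : Finset G) : Prop :=
  ∀ j, (∀ r : ℕ, j + r • t ∈ X) → ∃ r : ℕ, j + r • t ∈ C

theorem exists_meetsOrbits_two_mul_card_le [Finite G] {t : G} (ht : t ≠ 0) (X : Finset G) :
    ∃ C : Finset G, MeetsOrbits t X C ∧ 2 * C.card ≤ X.card := by
  classical
  let rep (j : G) : G := (QuotientAddGroup.mk j : G ⧸ AddSubgroup.zmultiples t).out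
  have rep_add (j : G) (r : ℕ) : rep (j + r • t) = rep j :=
    congrArg Quotient.out (QuotientAddGroup.mk_add_of_mem j
      (AddSubgroup.nsmul_mem_zmultiples t r))
  have exists_rep (j : G) : ∃ r : ℕ, j + r • t = rep j := by
    obtain ⟨⟨h, hh⟩, hj⟩ := QuotientAddGroup.mk_out_eq_add (AddSubgroup.zmultiples t) j
    obtain ⟨r, rfl⟩ := mem_multiples_iff_mem_zmultiples.2 hh
    exact ⟨r, hj.symm⟩
  let C := X.filter fun j => (∀ r : ℕ, j + r • t ∈ X) ∧ rep j = j
  refine ⟨C, fun j hj => ?_, ?_⟩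
  · obtain ⟨r, hr⟩ := exists_rep j
    refine ⟨r, Finset.mem_filter.2 ⟨hj r, fun r' => ?_, (rep_add j r).trans hr.symm⟩⟩
    rw [add_assoc, ← add_nsmul]
    exact hj _
  · have hdisj : Disjoint C (C.map (addRightEmbedding t)) := by
      refine Finset.disjoint_left.2 fun j hj hj' => ?_
      obtain ⟨i, hi, rfl⟩ := Finset.mem_map.1 hj'
      have hrep := rep_add i 1
      rw [one_nsmul, (Finset.mem_filter.1 hi).2.2] at hrep
      exact ht (add_eq_left.1 ((Finset.mem_filter.1 hj).2.2.symm.trans hrep))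
    have hsub : C ∪ C.map (addRightEmbedding t) ⊆ X := by
      refine Finset.union_subset (Finset.filter_subset _ _) fun j hj => ?_
      obtain ⟨i, hi, rfl⟩ := Finset.mem_map.1 hj
      simpa using (Finset.mem_filter.1 hi).2.1 1
    have := Finset.card_le_card hsub
    rw [Finset.card_union_of_disjoint hdisj, Finset.card_map] at this
    omega

/-- The data of an overlap between the translations by `n` and by `m` on the region `X`: both
`σ, τ` and their translates by `n` and `m`, respectively, agree on `X`. -/
def OverlapOn (X : Finset G) (n m : G) (σ τ : G → S) : Prop :=
  ∀ i ∈ X, σ i = τ i ∧ σ (i + n) = τ (i + m)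

theorem OverlapOn.eq_of_meetsOrbits {X C : Finset G} {n m : G} (hC : MeetsOrbits (m - n) X C)
    {σ τ σ' τ' : G → S} (h : OverlapOn X n m σ τ) (h' : OverlapOn X n m σ' τ')
    (hσ : ∀ i ∉ X, σ (i + n) = σ' (i + n)) (hτ : ∀ i ∉ X, τ i = τ' i)
    (hσC : ∀ i ∈ C, σ i = σ' i) : σ = σ' ∧ τ = τ' := by
  have hstep : ∀ j, σ j ≠ σ' j → j + (m - n) ∈ X ∧ σ (j + (m - n)) ≠ σ' (j + (m - n)) := by
    intro j hj
    have hjX : j - n ∈ X := by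
      by_contra hX
      exact hj (by simpa using hσ _ hX)
    have e := (h _ hjX).2
    have e' := (h' _ hjX).2
    rw [sub_add_cancel, sub_add_eq_add_sub, ← add_sub_assoc'] at e e'
    rw [e, e'] at hj
    have hX : j + (m - n) ∈ X := by
      by_contra hX
      exact hj (hτ _ hX)
    exact ⟨hX, by rwa [(h _ hX).1, (h' _ hX).1]⟩
  have hσσ' : σ = σ' := by
    by_contra hne
    obtain ⟨j, hj⟩ := Function.ne_iff.1 hne
    -- A disagreement propagates along an orbit of `m - n`, which therefore stays inside `X`.
    have horbit : ∀ r : ℕ, j + (m - n) + r • (m - n) ∈ X ∧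
        σ (j + (m - n) + r • (m - n)) ≠ σ' (j + (m - n) + r • (m - n)) := by
      intro r
      induction r with
      | zero => simpa using hstep j hj
      | succ r ih =>
        rw [succ_nsmul, ← add_assoc]
        exact hstep _ ih.2
    obtain ⟨r, hr⟩ := hC _ fun r => (horbit r).1
    exact (horbit r).2 (hσC _ hr)
  refine ⟨hσσ', funext fun i => ?_⟩
  by_cases hi : i ∈ X
  · rw [← (h i hi).1, ← (h' i hi).1, hσσ']
  · exact hτ i hi

theorem card_eq_shift_sq_le [Fintype G] [DecidableEq G] [Fintype S] [DecidableEq S] [Nonempty S]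
    {n m : G} (hnm : n ≠ m) :
    (Finset.univ.filter fun σ : G → S => ∀ i, σ (i + n) = σ (i + m)).card ^ 2 ≤
      Fintype.card S ^ Fintype.card G := by
  obtain ⟨C, hC, hcard⟩ :=
    exists_meetsOrbits_two_mul_card_le (sub_ne_zero.2 hnm.symm) (Finset.univ : Finset G)
  have hle : (Finset.univ.filter fun σ : G → S => ∀ i, σ (i + n) = σ (i + m)).card ≤
      Fintype.card S ^ C.card := by
    rw [← Fintype.card_coe C, ← Fintype.card_fun, ← Finset.card_univ]
    refine Finset.card_le_card_of_injOn (fun σ (i : C) => σ i) (fun _ _ => by simp) ?_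
    intro σ hσ σ' hσ' heq
    simp only [Finset.coe_filter, Finset.mem_univ, true_and, Set.mem_ofPred_eq] at hσ hσ'
    exact (OverlapOn.eq_of_meetsOrbits hC (fun i _ => ⟨rfl, hσ i⟩) (fun i _ => ⟨rfl, hσ' i⟩)
      (by simp) (by simp) fun i hi => congrFun heq ⟨i, hi⟩).1
  calc _ ≤ (Fintype.card S ^ C.card) ^ 2 := Nat.pow_le_pow_left hle 2
    _ = Fintype.card S ^ (2 * C.card) := by rw [← pow_mul, mul_comm]
    _ ≤ Fintype.card S ^ Fintype.card G := Nat.pow_le_pow_right Fintype.card_pos hcard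

end Orbits

section ShiftBlocks

theorem card_filter_eqOn {α β : Type*} [Fintype α] [DecidableEq α] [Fintype β] [DecidableEq β]
    (p : α → Prop) [DecidablePred p] (f : α → β) :
    (Finset.univ.filter fun g : α → β => ∀ a, ¬p a → f a = g a).card =
      Fintype.card β ^ (Finset.univ.filter p).card := by
  have hpi : (Finset.univ.filter fun g : α → β => ∀ a, ¬p a → f a = g a) =
      Fintype.piFinset fun a => if p a then Finset.univ else {f a} := by
    ext g
    simp only [Finset.mem_filter, Finset.mem_univ, true_and, Fintype.mem_piFinset]
    refine forall_congr' fun a => ?_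
    by_cases ha : p a <;> simp [ha, eq_comm]
  simp only [hpi, Fintype.card_piFinset, apply_ite Finset.card, Finset.card_univ,
    Finset.card_singleton, Finset.prod_ite, Finset.prod_const, one_pow, mul_one]

variable {G S U V : Type*} {X : Finset G}

/-- A splitting of the configurations `G → S` into a part in `U`, carried by the sites of `X`, and
a part in `V`, carried by the other sites. Keeping `U` and `V` abstract makes the two sides of the
bipartition interchangeable, see `RegionSplitting.swap`. -/
structure RegionSplitting (S U V : Type*) {G : Type*} (X : Finset G) where
  /-- Gluing the two parts of a configuration. -/
  glue : U × V ≃ (G → S)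
  glue_eq_of_mem : ∀ u v v' i, i ∈ X → glue (u, v) i = glue (u, v') i
  glue_eq_of_notMem : ∀ u u' v i, i ∉ X → glue (u, v) i = glue (u', v) i

namespace RegionSplitting

/-- The same splitting, seen from the complementary region. -/
def swap [Fintype G] [DecidableEq G] (e : RegionSplitting S U V X) :
    RegionSplitting S V U Xᶜ where
  glue := (Equiv.prodComm V U).trans e.glue
  glue_eq_of_mem v u u' i hi := e.glue_eq_of_notMem u u' v i (Finset.mem_compl.1 hi)
  glue_eq_of_notMem v v' u i hi := e.glue_eq_of_mem u v v' i (by simpa using hi)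

/-- Gluing pairs of parts to pairs of configurations, with the two parts carried by `X` first. -/
def glueBoth (e : RegionSplitting S U V X) : (U × U) × (V × V) ≃ (G → S) × (G → S) :=
  (Equiv.prodProdProdComm U U V V).trans (e.glue.prodCongr e.glue)

variable [AddCommGroup G]

/-- The two configurations glued from the pairs of parts `x` and `y` are translates of each other
by `n`. -/
def IsShift (e : RegionSplitting S U V X) (n : G) (x : U × U) (y : V × V) : Prop :=
  ∀ i, e.glue (x.1, y.1) (i + n) = e.glue (x.2, y.2) i

instance [Fintype G] [DecidableEq S] (e : RegionSplitting S U V X) (n : G) (x : U × U)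
    (y : V × V) : Decidable (e.IsShift n x y) :=
  inferInstanceAs (Decidable (∀ _, _))

theorem IsShift.isShift_iff {e : RegionSplitting S U V X} {n : G} {x x' : U × U} {y y' : V × V}
    (h : e.IsShift n x y) (h' : e.IsShift n x' y') :
    e.IsShift n x y' ↔
      ∀ i, ¬(i ∈ X ↔ i + n ∈ X) → e.glue (x.2, y.2) i = e.glue (x'.2, y'.2) i := by
  refine forall_congr' fun i => ?_
  have hi := h i
  have hi' := h' i
  by_cases hX : i ∈ X <;> by_cases hXn : i + n ∈ X
  · rw [e.glue_eq_of_mem _ _ y.1 _ hXn, e.glue_eq_of_mem _ _ y.2 _ hX]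
    simp [hX, hXn, hi]
  · rw [e.glue_eq_of_notMem _ x'.1 _ _ hXn, e.glue_eq_of_mem _ _ y.2 _ hX]
    simp [hX, hXn, hi', eq_comm]
  · rw [e.glue_eq_of_mem _ _ y.1 _ hXn, e.glue_eq_of_notMem _ x'.2 _ _ hX]
    simp [hX, hXn, hi]
  · rw [e.glue_eq_of_notMem _ x'.1 _ _ hXn, e.glue_eq_of_notMem _ x'.2 _ _ hX]
    simp [hX, hXn, hi']

theorem IsShift.isShift_comm {e : RegionSplitting S U V X} {n : G} {x x' : U × U} {y y' : V × V}
    (h : e.IsShift n x y) (h' : e.IsShift n x' y') : e.IsShift n x y' ↔ e.IsShift n x' y := by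
  rw [h.isShift_iff h', h'.isShift_iff h]
  simp only [eq_comm]

theorem IsShift.eq_of_meetsOrbits {e : RegionSplitting S U V X} {C : Finset G} {n m : G}
    (hC : MeetsOrbits (m - n) X C) {x x' : U × U} {y z y' z' : V × V}
    (hy : e.IsShift n x y) (hz : e.IsShift m x z) (hy' : e.IsShift n x' y')
    (hz' : e.IsShift m x' z') (hyV : y.2 = y'.2) (hzV : z.1 = z'.1)
    (hxC : ∀ i ∈ C, e.glue (x.1, y.1) i = e.glue (x'.1, y'.1) i) :
    x = x' ∧ y = y' ∧ z = z' := by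
  have overlap {x : U × U} {y z : V × V} (hy : e.IsShift n x y) (hz : e.IsShift m x z) :
      OverlapOn X n m (e.glue (x.1, y.1)) (e.glue (x.1, z.1)) := fun i hi =>
    ⟨e.glue_eq_of_mem _ _ _ i hi, by rw [hy, hz]; exact e.glue_eq_of_mem _ _ _ i hi⟩
  obtain ⟨hσ, hτ⟩ := (overlap hy hz).eq_of_meetsOrbits hC (overlap hy' hz')
    (fun i hi => by rw [hy, hy', hyV]; exact e.glue_eq_of_notMem _ _ _ i hi)
    (fun i hi => by rw [hzV]; exact e.glue_eq_of_notMem _ _ _ i hi) hxC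
  have hσ₂ : e.glue (x.2, y.2) = e.glue (x'.2, y'.2) := funext fun i => by rw [← hy, ← hy', hσ]
  have hτ₂ : e.glue (x.2, z.2) = e.glue (x'.2, z'.2) := funext fun i => by rw [← hz, ← hz', hτ]
  simp only [EmbeddingLike.apply_eq_iff_eq, Prod.mk.injEq] at hσ hτ hσ₂ hτ₂
  exact ⟨Prod.ext hσ.1 hσ₂.1, Prod.ext hσ.2 hσ₂.2, Prod.ext hτ.2 hτ₂.2⟩

variable [Fintype G] [DecidableEq S] (e : RegionSplitting S U V X)

/-- The vectorized translation by `n`, as a matrix between the two sides of the bipartition. -/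
def shiftBlock (n : G) : Matrix (U × U) (V × V) ℝ :=
  Matrix.of fun x y => if e.IsShift n x y then 1 else 0

theorem shiftBlock_nonneg (n : G) (x : U × U) (y : V × V) : 0 ≤ e.shiftBlock n x y := by
  rw [shiftBlock, Matrix.of_apply]
  positivity

theorem transpose_shiftBlock [DecidableEq G] (n : G) : (e.shiftBlock n)ᵀ = e.swap.shiftBlock n :=
  rfl

variable [Fintype S]

/-- The vectorized translation by `n`, normalized to Frobenius norm one. -/
noncomputable def unitBlock (n : G) : Matrix (U × U) (V × V) ℝ :=
  (√((Fintype.card S : ℝ) ^ Fintype.card G))⁻¹ • e.shiftBlock n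

theorem transpose_unitBlock [DecidableEq G] (n : G) : (e.unitBlock n)ᵀ = e.swap.unitBlock n := by
  rw [unitBlock, Matrix.transpose_smul, transpose_shiftBlock, unitBlock]

theorem unitBlock_nonneg (n : G) (x : U × U) (y : V × V) : 0 ≤ e.unitBlock n x y :=
  mul_nonneg (inv_nonneg.2 (Real.sqrt_nonneg _)) (e.shiftBlock_nonneg n x y)

theorem transpose_unitBlock_mul [Fintype U] (n m : G) :
    (e.unitBlock n)ᵀ * e.unitBlock m =
      ((Fintype.card S : ℝ) ^ Fintype.card G)⁻¹ • ((e.shiftBlock n)ᵀ * e.shiftBlock m) := by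
  rw [unitBlock, unitBlock, Matrix.transpose_smul, Matrix.smul_mul, Matrix.mul_smul, smul_smul,
    ← mul_inv, Real.mul_self_sqrt (by positivity)]

theorem unitBlock_mul_transpose [Fintype V] (n m : G) :
    e.unitBlock n * (e.unitBlock m)ᵀ =
      ((Fintype.card S : ℝ) ^ Fintype.card G)⁻¹ • (e.shiftBlock n * (e.shiftBlock m)ᵀ) := by
  classical
  simpa only [← transpose_unitBlock, ← transpose_shiftBlock, Matrix.transpose_transpose] using
    e.swap.transpose_unitBlock_mul n m

/-- The reduced density matrix, on the two copies of `X`, of the superposition of all vectorized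
translations, scaled so that each single translation has trace one. -/
noncomputable def gram [Fintype V] : Matrix (U × U) (U × U) ℝ :=
  (∑ n, e.unitBlock n) * (∑ n, e.unitBlock n)ᵀ

theorem trace_gram [Fintype U] [Fintype V] :
    e.gram.trace = ∑ n, ∑ m, (e.unitBlock n * (e.unitBlock m)ᵀ).trace := by
  simp only [gram, Matrix.transpose_sum, Matrix.sum_mul, Matrix.mul_sum, Matrix.trace_sum]
  exact Finset.sum_comm

variable [Fintype U] [Fintype V]

theorem sum_shiftBlock_mul [DecidableEq G] (n : G) (F : (G → S) → (G → S) → ℝ) :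
    ∑ x, ∑ y, e.shiftBlock n x y * F (e.glue (x.1, y.1)) (e.glue (x.2, y.2)) =
      ∑ σ, F σ fun i => σ (i + n) := by
  rw [← Fintype.sum_prod_type']
  refine (e.glueBoth.sum_comp fun p =>
    (if ∀ i, p.1 (i + n) = p.2 i then 1 else 0) * F p.1 p.2).trans ?_
  simp only [Fintype.sum_prod_type, ← funext_iff, ite_mul, one_mul, zero_mul, Finset.sum_ite_eq,
    Finset.mem_univ, if_true]

theorem trace_shiftBlock_mul_transpose [DecidableEq G] (n m : G) :
    (e.shiftBlock m * (e.shiftBlock n)ᵀ).trace =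
      (Finset.univ.filter fun σ : G → S => ∀ i, σ (i + n) = σ (i + m)).card := by
  have h := e.sum_shiftBlock_mul m fun σ τ => if ∀ i, σ (i + n) = τ i then 1 else 0
  rwa [Finset.sum_boole] at h

theorem trace_shiftBlock_mul_transpose_self (n : G) :
    (e.shiftBlock n * (e.shiftBlock n)ᵀ).trace = (Fintype.card S : ℝ) ^ Fintype.card G := by
  classical
  simp [trace_shiftBlock_mul_transpose]

theorem sq_trace_shiftBlock_mul_transpose_le [Nonempty S] {n m : G} (hnm : n ≠ m) :
    (e.shiftBlock n * (e.shiftBlock m)ᵀ).trace ^ 2 ≤ (Fintype.card S : ℝ) ^ Fintype.card G := by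
  classical
  rw [trace_shiftBlock_mul_transpose]
  exact_mod_cast card_eq_shift_sq_le hnm.symm

theorem frobSq_transpose_shiftBlock_mul_le {C : Finset G} {n m : G}
    (hC : MeetsOrbits (m - n) X C) :
    frobSq ((e.shiftBlock n)ᵀ * e.shiftBlock m) ≤
      (Fintype.card V : ℝ) ^ 2 * (Fintype.card S : ℝ) ^ (2 * C.card) := by
  classical
  let overlaps : Finset (((V × V) × (V × V)) × ((U × U) × (U × U))) :=
    Finset.univ.filter fun p => (e.IsShift n p.2.1 p.1.1 ∧ e.IsShift m p.2.1 p.1.2) ∧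
      e.IsShift n p.2.2 p.1.1 ∧ e.IsShift m p.2.2 p.1.2
  have hcount : frobSq ((e.shiftBlock n)ᵀ * e.shiftBlock m) = overlaps.card := by
    simp only [frobSq, shiftBlock, Matrix.mul_apply, Matrix.transpose_apply, Matrix.of_apply,
      ite_zero_mul_ite_zero, mul_one, sq, Finset.sum_mul_sum]
    simp only [overlaps, Finset.card_filter, Nat.cast_sum, Nat.cast_ite, Nat.cast_one,
      Nat.cast_zero, Fintype.sum_prod_type]
  have hinj : overlaps.card ≤ Fintype.card ((V × V) × ((C → S) × (C → S))) := by
    refine Finset.card_le_card_of_injOn (fun p => ((p.1.1.2, p.1.2.1),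
      (fun i => e.glue (p.2.1.1, p.1.1.1) i, fun i => e.glue (p.2.2.1, p.1.1.1) i)))
      (fun _ _ => Finset.mem_univ _) ?_
    rintro ⟨⟨y, z⟩, x₁, x₂⟩ h ⟨⟨y', z'⟩, x₁', x₂'⟩ h' heq
    simp only [overlaps, Finset.coe_filter, Finset.mem_univ, true_and, Set.mem_ofPred_eq] at h h'
    simp only [Prod.mk.injEq] at heq
    obtain ⟨⟨hyV, hzV⟩, h₁C, h₂C⟩ := heq
    obtain ⟨rfl, rfl, rfl⟩ := h.1.1.eq_of_meetsOrbits hC h.1.2 h'.1.1 h'.1.2 hyV hzV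
      fun i hi => congrFun h₁C ⟨i, hi⟩
    obtain ⟨rfl, -, -⟩ := h.2.1.eq_of_meetsOrbits hC h.2.2 h'.2.1 h'.2.2 rfl rfl
      fun i hi => congrFun h₂C ⟨i, hi⟩
    rfl
  rw [hcount]
  refine (Nat.cast_le.2 hinj).trans_eq ?_
  simp only [Fintype.card_prod, Fintype.card_fun, Fintype.card_coe]
  push_cast
  ring

theorem shiftBlock_mul_transpose_mul_self [DecidableEq G] (n : G) :
    e.shiftBlock n * (e.shiftBlock n)ᵀ * e.shiftBlock n =
      (Fintype.card S : ℝ) ^ (Finset.univ.filter fun i => i ∈ X ↔ i + n ∈ X).card •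
        e.shiftBlock n := by
  ext x y
  have hentry : (e.shiftBlock n * (e.shiftBlock n)ᵀ * e.shiftBlock n) x y =
      ∑ x', ∑ y', e.shiftBlock n x' y' * if e.IsShift n x y' ∧ e.IsShift n x' y then 1 else 0 := by
    simp only [Matrix.mul_apply, Matrix.transpose_apply, Finset.sum_mul, shiftBlock,
      Matrix.of_apply, ite_zero_mul_ite_zero, mul_one]
    simp only [and_assoc, and_left_comm]
  rw [hentry, Matrix.smul_apply, smul_eq_mul]
  by_cases hxy : e.IsShift n x y
  · have hiff (x' : U × U) (y' : V × V) : (e.shiftBlock n x' y' *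
        if e.IsShift n x y' ∧ e.IsShift n x' y then 1 else 0) = e.shiftBlock n x' y' *
          if ∀ i, ¬(i ∈ X ↔ i + n ∈ X) → e.glue (x.2, y.2) i = e.glue (x'.2, y'.2) i
            then 1 else 0 := by
      by_cases h' : e.IsShift n x' y'
      · have := hxy.isShift_iff h'
        simp only [← hxy.isShift_comm h', and_self, this]
      · simp [shiftBlock, h']
    simp only [hiff]
    rw [e.sum_shiftBlock_mul n fun _ τ =>
      if ∀ i, ¬(i ∈ X ↔ i + n ∈ X) → e.glue (x.2, y.2) i = τ i then 1 else 0]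
    refine ((Equiv.arrowCongr (Equiv.subRight n) (Equiv.refl S)).sum_comp fun τ =>
      if ∀ i, ¬(i ∈ X ↔ i + n ∈ X) → e.glue (x.2, y.2) i = τ i then (1 : ℝ) else 0).trans ?_
    rw [Finset.sum_boole, card_filter_eqOn]
    simp [shiftBlock, hxy]
  · have hzero (x' : U × U) (y' : V × V) : (e.shiftBlock n x' y' *
        if e.IsShift n x y' ∧ e.IsShift n x' y then 1 else 0) = (0 : ℝ) := by
      by_cases h : e.IsShift n x y' ∧ e.IsShift n x' y
      · simp [shiftBlock, mt (h.1.isShift_comm h.2).2 hxy]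
      · simp [h]
    simp only [hzero, Finset.sum_const_zero]
    simp [shiftBlock, hxy]

theorem frobSq_transpose_unitBlock_mul_le {C : Finset G} {n m : G}
    (hC : MeetsOrbits (m - n) X C) :
    frobSq ((e.unitBlock n)ᵀ * e.unitBlock m) ≤
      (((Fintype.card S : ℝ) ^ Fintype.card G)⁻¹) ^ 2 *
        ((Fintype.card V : ℝ) ^ 2 * (Fintype.card S : ℝ) ^ (2 * C.card)) := by
  rw [transpose_unitBlock_mul, frobSq_smul]
  gcongr
  exact e.frobSq_transpose_shiftBlock_mul_le hC

variable [Nonempty S]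

theorem trace_unitBlock_mul_transpose_self (n : G) :
    (e.unitBlock n * (e.unitBlock n)ᵀ).trace = 1 := by
  rw [unitBlock_mul_transpose, Matrix.trace_smul, trace_shiftBlock_mul_transpose_self,
    smul_eq_mul, inv_mul_cancel₀]
  positivity

theorem abs_trace_unitBlock_mul_transpose_le {n m : G} (hnm : n ≠ m) :
    |(e.unitBlock n * (e.unitBlock m)ᵀ).trace| ≤
      (√((Fintype.card S : ℝ) ^ Fintype.card G))⁻¹ := by
  refine abs_le_of_sq_le_sq ?_ (by positivity)
  rw [unitBlock_mul_transpose, Matrix.trace_smul, smul_eq_mul, mul_pow, inv_pow, inv_pow,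
    Real.sq_sqrt (by positivity), inv_mul_le_iff₀ (by positivity)]
  refine (e.sq_trace_shiftBlock_mul_transpose_le hnm).trans_eq ?_
  field_simp

theorem unitBlock_mul_transpose_mul_self [DecidableEq G] (n : G) :
    e.unitBlock n * (e.unitBlock n)ᵀ * e.unitBlock n =
      ((Fintype.card S : ℝ) ^ (Finset.univ.filter fun i => ¬(i ∈ X ↔ i + n ∈ X)).card)⁻¹ •
        e.unitBlock n := by
  have hcard := Finset.card_filter_add_card_filter_not (s := (Finset.univ : Finset G))
    fun i => i ∈ X ↔ i + n ∈ X
  rw [Finset.card_univ] at hcard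
  rw [unitBlock_mul_transpose, unitBlock, Matrix.smul_mul, Matrix.mul_smul,
    shiftBlock_mul_transpose_mul_self, smul_comm _ (√_)⁻¹, smul_comm _ (√_)⁻¹, smul_smul (_ ^ _)⁻¹,
    ← hcard, pow_add, mul_inv_rev, inv_mul_cancel_right₀ (by positivity)]

theorem card_le_trace_gram : (Fintype.card G : ℝ) ≤ e.gram.trace := by
  rw [trace_gram, ← nsmul_one, ← Finset.card_univ]
  refine Finset.card_nsmul_le_sum _ _ _ fun n _ => ?_
  rw [← e.trace_unitBlock_mul_transpose_self n]
  refine Finset.single_le_sum (f := fun m => (e.unitBlock n * (e.unitBlock m)ᵀ).trace)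
    (fun m _ => ?_) (Finset.mem_univ n)
  exact Finset.sum_nonneg fun x _ => Finset.sum_nonneg fun y _ =>
    mul_nonneg (e.unitBlock_nonneg n x y) (e.unitBlock_nonneg m x y)

theorem trace_gram_le :
    e.gram.trace ≤ Fintype.card G +
      (Fintype.card G : ℝ) ^ 2 * (√((Fintype.card S : ℝ) ^ Fintype.card G))⁻¹ := by
  classical
  let κ := (√((Fintype.card S : ℝ) ^ Fintype.card G))⁻¹
  have hentry (n m : G) :
      (e.unitBlock n * (e.unitBlock m)ᵀ).trace ≤ (if n = m then 1 else 0) + κ := by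
    split_ifs with h
    · rw [h, trace_unitBlock_mul_transpose_self]
      exact le_add_of_nonneg_right (by positivity)
    · rw [zero_add]
      exact (le_abs_self _).trans (e.abs_trace_unitBlock_mul_transpose_le h)
  calc e.gram.trace ≤ ∑ n : G, ∑ m : G, ((if n = m then 1 else 0) + κ) := by
        rw [trace_gram]
        exact Finset.sum_le_sum fun n _ => Finset.sum_le_sum fun m _ => hentry n m
    _ = Fintype.card G + (Fintype.card G : ℝ) ^ 2 * κ := by
        simp [Finset.sum_add_distrib, sq, mul_assoc]

end RegionSplitting

end ShiftBlocks

section Intervals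

variable {L : ℕ} [NeZero L] {A : Finset (ZMod L)}

theorem IsRingInterval.exists_mem_iff (hA : IsRingInterval A) :
    ∃ s : ZMod L, ∀ j, j ∈ A ↔ (j - s).val < A.card := by
  obtain ⟨s, a, rfl⟩ := hA
  refine ⟨s, fun j => ?_⟩
  have hmem (j : ZMod L) :
      j ∈ (Finset.range a).image (fun i : ℕ => s + (i : ZMod L)) ↔ (j - s).val < a := by
    simp only [Finset.mem_image, Finset.mem_range]
    constructor
    · rintro ⟨i, hi, rfl⟩
      rw [add_sub_cancel_left, ZMod.val_natCast]
      exact (Nat.mod_le _ _).trans_lt hi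
    · exact fun h => ⟨_, h, by simp⟩
  rw [hmem]
  rcases le_total L a with h | h
  · have huniv : (Finset.range a).image (fun i : ℕ => s + (i : ZMod L)) = Finset.univ :=
      Finset.eq_univ_iff_forall.2 fun i => (hmem i).2 ((ZMod.val_lt _).trans_le h)
    rw [huniv, Finset.card_univ, ZMod.card]
    exact iff_of_true ((ZMod.val_lt _).trans_le h) (ZMod.val_lt _)
  · rw [Finset.card_image_of_injOn, Finset.card_range]
    intro i hi j hj hij
    rw [Finset.coe_range, Set.mem_Iio] at hi hj
    have hval := congrArg ZMod.val (add_left_cancel hij)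
    rwa [ZMod.val_natCast_of_lt (hi.trans_le h), ZMod.val_natCast_of_lt (hj.trans_le h)] at hval

theorem val_add_eq_or (x y : ZMod L) :
    (x + y).val = x.val + y.val ∧ x.val + y.val < L ∨
      (x + y).val + L = x.val + y.val ∧ L ≤ x.val + y.val := by
  rcases lt_or_ge (x.val + y.val) L with h | h
  · exact Or.inl ⟨ZMod.val_add_of_lt h, h⟩
  · exact Or.inr ⟨(ZMod.val_add_val_of_le h).symm, h⟩

theorem IsRingInterval.meetsOrbits_empty (hA : IsRingInterval A) (hL : 2 * A.card ≤ L)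
    {t : ZMod L} (ht : t ≠ 0) : MeetsOrbits t A ∅ := by
  obtain ⟨s, hs⟩ := hA.exists_mem_iff
  intro j hj
  exfalso
  obtain ⟨_, ⟨r, rfl⟩, hmax⟩ := Set.exists_max_image (Set.range fun r : ℕ => j + r • t)
    (fun i => (i - s).val) (Set.toFinite _) ⟨_, 0, rfl⟩
  -- The last visited point is moved across the end of the ring by `t`, hence past itself by `-t`.
  have hmem := (hs _).1 (hj r)
  have hnext : (j + r • t - s + t).val ≤ (j + r • t - s).val := by
    refine le_of_eq_of_le (congrArg ZMod.val ?_) (hmax _ ⟨r + 1, rfl⟩)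
    simp only [succ_nsmul]
    abel
  have hprev : (j + r • t - s - t).val ≤ (j + r • t - s).val := by
    obtain ⟨q, hq⟩ := mem_multiples_iff_mem_zmultiples.2
      (neg_mem (AddSubgroup.mem_zmultiples t))
    refine le_of_eq_of_le (congrArg ZMod.val ?_) (hmax _ ⟨r + q, rfl⟩)
    simp only [add_nsmul, show q • t = -t from hq]
    abel
  have hstep := val_add_eq_or (j + r • t - s) t
  have hback := val_add_eq_or (j + r • t - s - t) t
  rw [sub_add_cancel] at hback
  have htpos : t.val ≠ 0 := mt (ZMod.val_eq_zero t).1 ht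
  have htlt := ZMod.val_lt t
  omega

theorem IsRingInterval.card_filter_mem_and_add_notMem (hA : IsRingInterval A)
    (hL : 2 * A.card ≤ L) (n : ZMod L) :
    (Finset.univ.filter fun i => i ∈ A ∧ i + n ∉ A).card =
      min n.val (min (L - n.val) A.card) := by
  obtain ⟨s, hs⟩ := hA.exists_mem_iff
  have hn := ZMod.val_lt n
  have hcard : (Finset.univ.filter fun i => i ∈ A ∧ i + n ∉ A).card =
      (Finset.Ico (A.card - n.val) (min A.card (L - n.val))).card := by
    refine Finset.card_bij (fun i _ => (i - s).val) (fun i hi => ?_)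
      (fun i _ j _ hij => sub_left_injective (ZMod.val_injective L hij)) fun p hp => ?_
    · simp only [Finset.mem_filter, Finset.mem_univ, true_and, hs] at hi
      have hval := val_add_eq_or (i - s) n
      rw [sub_add_eq_add_sub] at hval
      rw [Finset.mem_Ico]
      omega
    · rw [Finset.mem_Ico] at hp
      have hp_val : (p : ZMod L).val = p := ZMod.val_natCast_of_lt (by omega)
      refine ⟨p + s, ?_, by rw [add_sub_cancel_right, hp_val]⟩
      simp only [Finset.mem_filter, Finset.mem_univ, true_and, hs]
      have hval := val_add_eq_or (p : ZMod L) n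
      rw [add_sub_cancel_right, add_right_comm, add_sub_cancel_right]
      omega
  rw [hcard, Nat.card_Ico]
  omega

theorem card_filter_not_mem_iff_add_mem {G : Type*} [AddCommGroup G] [Fintype G] [DecidableEq G]
    (X : Finset G) (n : G) :
    (Finset.univ.filter fun i => ¬(i ∈ X ↔ i + n ∈ X)).card =
      2 * (Finset.univ.filter fun i => i ∈ X ∧ i + n ∉ X).card := by
  let Y := X.map (Equiv.subRight n).toEmbedding
  have mem_Y (i : G) : i ∈ Y ↔ i + n ∈ X := by simp [Y, Finset.mem_map_equiv]
  have hout : (Finset.univ.filter fun i => i ∈ X ∧ i + n ∉ X) = X \ Y := by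
    ext i
    simp [mem_Y]
  have hsymm : (Finset.univ.filter fun i => ¬(i ∈ X ↔ i + n ∈ X)) = X \ Y ∪ Y \ X := by
    ext i
    simp only [Finset.mem_filter, Finset.mem_univ, true_and, Finset.mem_union, Finset.mem_sdiff,
      mem_Y]
    tauto
  rw [hout, hsymm, Finset.card_union_of_disjoint disjoint_sdiff_sdiff,
    Finset.card_sdiff_comm (Finset.card_map _), two_mul]

end Intervals

section CrossingWeights

variable {x : ℝ}

theorem sum_range_pow_add_pow_sub (hx : x ≠ 1) (L : ℕ) :
    ∑ j ∈ Finset.range L, (x ^ j + x ^ (L - j)) = (1 + x) / (1 - x) * (1 - x ^ L) := by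
  have hreflect : ∑ j ∈ Finset.range L, x ^ (L - j) = x * ∑ j ∈ Finset.range L, x ^ j := by
    rw [← Finset.sum_range_reflect, Finset.mul_sum]
    refine Finset.sum_congr rfl fun j hj => ?_
    rw [← pow_succ']
    congr 1
    have := Finset.mem_range.1 hj
    omega
  have h₁ : 1 - x ≠ 0 := sub_ne_zero.2 hx.symm
  have h₂ : x - 1 ≠ 0 := sub_ne_zero.2 hx
  rw [Finset.sum_add_distrib, hreflect, geom_sum_eq hx]
  field_simp
  ring

theorem abs_pow_min_sub_pow_add_pow_le (hx₀ : 0 ≤ x) (hx₁ : x ≤ 1) {j a L : ℕ} (ha : 2 * a ≤ L) :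
    |x ^ min j (min (L - j) a) - (x ^ j + x ^ (L - j))| ≤ x ^ a := by
  have hmono {i j : ℕ} (h : i ≤ j) : x ^ j ≤ x ^ i := pow_le_pow_of_le_one hx₀ hx₁ h
  have hpos (i : ℕ) : 0 ≤ x ^ i := pow_nonneg hx₀ i
  rw [abs_le]
  rcases le_total j a with hj | hj
  · rw [min_eq_left (by omega)]
    constructor <;> linarith [hmono (show a ≤ L - j by omega), hpos (L - j), hpos a]
  · rcases le_total (L - j) a with hLj | hLj
    · rw [min_eq_left hLj, min_eq_right (by omega)]
      constructor <;> linarith [hmono hj, hpos j, hpos a]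
    · rw [min_eq_right hLj, min_eq_right hj]
      constructor <;> linarith [hmono hj, hmono hLj, hpos j, hpos (L - j)]

theorem abs_sum_pow_min_sub_le (hx₀ : 0 ≤ x) (hx₁ : x < 1) {a L : ℕ} (ha : 2 * a ≤ L) :
    |∑ j ∈ Finset.range L, x ^ min j (min (L - j) a) - (1 + x) / (1 - x)| ≤
      (L + (1 + x) / (1 - x)) * x ^ a := by
  have hX : 0 ≤ (1 + x) / (1 - x) := div_nonneg (by linarith) (by linarith)
  have hsplit : ∑ j ∈ Finset.range L, x ^ min j (min (L - j) a) - (1 + x) / (1 - x) =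
      ∑ j ∈ Finset.range L, (x ^ min j (min (L - j) a) - (x ^ j + x ^ (L - j))) -
        (1 + x) / (1 - x) * x ^ L := by
    rw [Finset.sum_sub_distrib, sum_range_pow_add_pow_sub hx₁.ne]
    ring
  have hsum : |∑ j ∈ Finset.range L, (x ^ min j (min (L - j) a) - (x ^ j + x ^ (L - j)))| ≤
      L * x ^ a := by
    refine (Finset.abs_sum_le_sum_abs _ _).trans ((Finset.sum_le_sum fun j _ =>
      abs_pow_min_sub_pow_add_pow_le hx₀ hx₁.le ha).trans_eq ?_)
    simp
  have htail : |(1 + x) / (1 - x) * x ^ L| ≤ (1 + x) / (1 - x) * x ^ a := by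
    rw [abs_of_nonneg (by positivity)]
    exact mul_le_mul_of_nonneg_left (pow_le_pow_of_le_one hx₀ hx₁.le (by omega)) hX
  rw [hsplit, add_mul]
  exact (abs_sub _ _).trans (add_le_add hsum htail)

theorem one_le_sum_pow_min (hx₀ : 0 ≤ x) {L : ℕ} (hL : 0 < L) (a : ℕ) :
    1 ≤ ∑ j ∈ Finset.range L, x ^ min j (min (L - j) a) := by
  have h := Finset.single_le_sum (f := fun j => x ^ min j (min (L - j) a))
    (fun j _ => pow_nonneg hx₀ _) (Finset.mem_range.2 hL)
  simpa using h

end CrossingWeights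

section RingBlocks

variable {L d : ℕ} [NeZero L] {A : Finset (ZMod L)}

/-- The splitting of the configurations of the ring given by `glueConfig`. -/
def ringSplitting (d : ℕ) (A : Finset (ZMod L)) :
    RegionSplitting (Fin d) ({i // i ∈ A} → Fin d) ({i // i ∉ A} → Fin d) A where
  glue := (Equiv.piEquivPiSubtypeProd (· ∈ A) fun _ => Fin d).symm
  glue_eq_of_mem u v v' i hi := by simp [Equiv.piEquivPiSubtypeProd, hi]
  glue_eq_of_notMem u u' v i hi := by simp [Equiv.piEquivPiSubtypeProd, hi]

/-- The size `d^(-2a) + d^(-L/2)` of the overlap of two distinct translations of a ring of `L`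
sites that is cut along an interval of `a` sites. -/
noncomputable def overlapScale (L d a : ℕ) : ℝ :=
  (d : ℝ) ^ (-(2 * (a : ℝ))) + (d : ℝ) ^ (-((L : ℝ) / 2))

theorem inv_sqrt_card_pow (L d : ℕ) [NeZero L] :
    (√((Fintype.card (Fin d) : ℝ) ^ Fintype.card (ZMod L)))⁻¹ = (d : ℝ) ^ (-((L : ℝ) / 2)) := by
  rw [Fintype.card_fin, ZMod.card, Real.sqrt_eq_rpow, ← Real.rpow_natCast_mul (by positivity),
    ← Real.rpow_neg (by positivity), mul_one_div]

theorem card_pow_mul_card_notMem (d : ℕ) (A : Finset (ZMod L)) :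
    (d : ℝ) ^ A.card * (Fintype.card ({i // i ∉ A} → Fin d) : ℝ) = (d : ℝ) ^ L := by
  have h := Fintype.card_congr (ringSplitting d A).glue
  have hA : Fintype.card ({i // i ∈ A} → Fin d) = d ^ A.card := by simp
  have hL : Fintype.card (RingConfig L d) = d ^ L := by simp
  rw [Fintype.card_prod, hA, hL] at h
  exact_mod_cast h

theorem frobSq_transpose_ringBlock_mul_le (hd : 1 ≤ d) (hA : IsRingInterval A)
    (hL : 2 * A.card ≤ L) {n m : ZMod L} (hnm : n ≠ m) :
    frobSq (((ringSplitting d A).unitBlock n)ᵀ * (ringSplitting d A).unitBlock m) ≤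
      (d : ℝ) ^ (-(2 * (A.card : ℝ))) := by
  have hd₀ : (0 : ℝ) < d := by exact_mod_cast hd
  refine ((ringSplitting d A).frobSq_transpose_unitBlock_mul_le
    (hA.meetsOrbits_empty hL (sub_ne_zero.2 hnm.symm))).trans_eq ?_
  have hcard := card_pow_mul_card_notMem d A
  have hpos : (0 : ℝ) < (d : ℝ) ^ A.card * (Fintype.card ({i // i ∉ A} → Fin d) : ℝ) := by
    rw [hcard]
    positivity
  have hne := right_ne_zero_of_mul hpos.ne'
  rw [Real.rpow_neg hd₀.le, Real.rpow_mul_natCast hd₀.le, Real.rpow_two, Fintype.card_fin,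
    ZMod.card, ← hcard, Finset.card_empty, mul_zero, pow_zero, mul_one]
  field_simp
  ring

theorem frobSq_ringBlock_mul_transpose_le (hd : 1 ≤ d) (hL : 2 * A.card ≤ L) {n m : ZMod L}
    (hnm : n ≠ m) :
    frobSq ((ringSplitting d A).unitBlock n * ((ringSplitting d A).unitBlock m)ᵀ) ≤
      (d : ℝ) ^ (-((L : ℝ) / 2)) := by
  have hd₀ : (0 : ℝ) < d := by exact_mod_cast hd
  have hd₁ : (1 : ℝ) ≤ d := by exact_mod_cast hd
  obtain ⟨C, hC, hcard⟩ := exists_meetsOrbits_two_mul_card_le (sub_ne_zero.2 hnm.symm) Aᶜ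
  have hfrob := (ringSplitting d A).swap.frobSq_transpose_unitBlock_mul_le hC
  rw [← RegionSplitting.transpose_unitBlock, ← RegionSplitting.transpose_unitBlock,
    Matrix.transpose_transpose] at hfrob
  refine hfrob.trans ?_
  rw [Finset.card_compl, ZMod.card] at hcard
  rw [Fintype.card_fun, Fintype.card_coe, Fintype.card_fin, ZMod.card]
  calc (((d : ℝ) ^ L)⁻¹) ^ 2 * (((d ^ A.card : ℕ) : ℝ) ^ 2 * (d : ℝ) ^ (2 * C.card))
      ≤ (((d : ℝ) ^ L)⁻¹) ^ 2 * (((d ^ A.card : ℕ) : ℝ) ^ 2 * (d : ℝ) ^ (L - A.card)) := by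
        gcongr
    _ = (d : ℝ) ^ ((A.card : ℝ) - L) := by
        rw [pow_sub₀ _ hd₀.ne' (by omega), Real.rpow_sub hd₀, Real.rpow_natCast, Real.rpow_natCast]
        push_cast
        field_simp
    _ ≤ (d : ℝ) ^ (-((L : ℝ) / 2)) := by
        have : (2 : ℝ) * A.card ≤ L := by exact_mod_cast hL
        exact Real.rpow_le_rpow_of_exponent_le hd₁ (by linarith)

theorem abs_trace_ringBlock_mul_transpose_le (hd : 1 ≤ d) {n m : ZMod L} (hnm : n ≠ m) :
    |((ringSplitting d A).unitBlock n * ((ringSplitting d A).unitBlock m)ᵀ).trace| ≤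
      (d : ℝ) ^ (-((L : ℝ) / 2)) := by
  have : Nonempty (Fin d) := ⟨⟨0, hd⟩⟩
  rw [← inv_sqrt_card_pow]
  exact (ringSplitting d A).abs_trace_unitBlock_mul_transpose_le hnm

theorem sum_inv_pow_card_crossing_pow (d k : ℕ) (hA : IsRingInterval A) (hL : 2 * A.card ≤ L) :
    ∑ n : ZMod L, (((Fintype.card (Fin d) : ℝ) ^
        (Finset.univ.filter fun i => ¬(i ∈ A ↔ i + n ∈ A)).card)⁻¹) ^ k =
      ∑ j ∈ Finset.range L, (((d : ℝ) ^ (2 * k))⁻¹) ^ min j (min (L - j) A.card) := by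
  refine Finset.sum_bij (fun n _ => n.val) (fun n _ => Finset.mem_range.2 (ZMod.val_lt n))
    (fun n _ m _ h => ZMod.val_injective L h) (fun j hj => ⟨j, Finset.mem_univ _,
      ZMod.val_natCast_of_lt (Finset.mem_range.1 hj)⟩) fun n _ => ?_
  rw [card_filter_not_mem_iff_add_mem, hA.card_filter_mem_and_add_notMem hL, Fintype.card_fin,
    inv_pow, inv_pow, ← pow_mul, ← pow_mul, mul_right_comm]

theorem sum_pow_le_trace_gram_pow {k : ℕ} (hd : 1 ≤ d) (hk : 2 ≤ k) (hA : IsRingInterval A)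
    (hL : 2 * A.card ≤ L) :
    ∑ j ∈ Finset.range L, (((d : ℝ) ^ (2 * (k - 1)))⁻¹) ^ min j (min (L - j) A.card) ≤
      ((ringSplitting d A).gram ^ k).trace := by
  have : Nonempty (Fin d) := ⟨⟨0, hd⟩⟩
  rw [← sum_inv_pow_card_crossing_pow d (k - 1) hA hL]
  exact sum_pow_le_trace_sum_mul_transpose_pow
    (ringSplitting d A).unitBlock_mul_transpose_mul_self
    (ringSplitting d A).trace_unitBlock_mul_transpose_self (ringSplitting d A).unitBlock_nonneg
    (by omega)

theorem abs_trace_gram_pow_sub_sum_pow_le {k : ℕ} (hd : 1 ≤ d) (hk : 2 ≤ k)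
    (hA : IsRingInterval A) (hL : 2 * A.card ≤ L) :
    |((ringSplitting d A).gram ^ k).trace -
        ∑ j ∈ Finset.range L, (((d : ℝ) ^ (2 * (k - 1)))⁻¹) ^ min j (min (L - j) A.card)| ≤
      (L : ℝ) ^ (2 * k) * overlapScale L d A.card := by
  have : Nonempty (Fin d) := ⟨⟨0, hd⟩⟩
  have hd₁ : (1 : ℝ) ≤ Fintype.card (Fin d) := by simpa using hd
  have hpos : 0 ≤ (d : ℝ) ^ (-(2 * (A.card : ℝ))) := by positivity
  have hpos' : 0 ≤ (d : ℝ) ^ (-((L : ℝ) / 2)) := by positivity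
  have h := abs_trace_sum_mul_transpose_pow_sub_le
    (ringSplitting d A).unitBlock_mul_transpose_mul_self
    (ringSplitting d A).trace_unitBlock_mul_transpose_self (fun n => by positivity)
    (fun n => inv_le_one_of_one_le₀ (one_le_pow₀ hd₁)) hk
    (ε := overlapScale L d A.card) (add_nonneg hpos hpos')
    (fun n m hnm => by
      rw [overlapScale]
      linarith [frobSq_ringBlock_mul_transpose_le hd hL hnm,
        frobSq_transpose_ringBlock_mul_le hd hA hL hnm])
    (fun n m hnm => (abs_trace_ringBlock_mul_transpose_le hd hnm).trans
      (le_add_of_nonneg_left hpos))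
  rwa [sum_inv_pow_card_crossing_pow d (k - 1) hA hL, ZMod.card] at h

end RingBlocks

section TranslationSymmetricState

variable {L d : ℕ} [NeZero L]

theorem translationOp_pow_apply (n : ℕ) (τ σ : RingConfig L d) :
    (translationOp L d ^ n) τ σ = if ∀ i, τ (i + n) = σ i then 1 else 0 := by
  induction n generalizing τ σ with
  | zero => simp only [pow_zero, Matrix.one_apply, Nat.cast_zero, add_zero, funext_iff]
  | succ n ih =>
    rw [pow_succ', Matrix.mul_apply, Finset.sum_eq_single fun i => τ (i + 1)]
    · rw [ih, translationOp, Matrix.of_apply, if_pos fun _ => rfl, one_mul]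
      simp only [Nat.cast_add, Nat.cast_one, add_assoc]
    · intro ρ _ hρ
      rw [translationOp, Matrix.of_apply, if_neg, zero_mul]
      exact fun h => hρ (funext fun i => (h i).symm)
    · simp

theorem translationProjector_apply (τ σ : RingConfig L d) :
    translationProjector L d τ σ =
      (L : ℂ)⁻¹ * (Finset.univ.filter fun n : ZMod L => ∀ i, τ (i + n) = σ i).card := by
  rw [translationProjector, Matrix.smul_apply, Matrix.sum_apply, smul_eq_mul, ← Finset.sum_boole]
  simp only [translationOp_pow_apply]
  congr 1
  refine (Finset.sum_bij (fun n _ => n.val) (fun n _ => Finset.mem_range.2 (ZMod.val_lt n))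
    (fun n _ m _ h => ZMod.val_injective L h) (fun j hj => ⟨j, Finset.mem_univ _,
      ZMod.val_natCast_of_lt (Finset.mem_range.1 hj)⟩) fun n _ => ?_).symm
  rw [ZMod.natCast_zmod_val]

theorem trace_translationProjector_ne_zero (hd : 1 ≤ d) : (translationProjector L d).trace ≠ 0 := by
  have : Nonempty (Fin d) := ⟨⟨0, hd⟩⟩
  have hcount : 0 < ∑ σ : RingConfig L d,
      (Finset.univ.filter fun n : ZMod L => ∀ i, σ (i + n) = σ i).card :=
    Finset.sum_pos (fun σ _ => Finset.card_pos.2 ⟨0, by simp⟩) Finset.univ_nonempty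
  simp only [Matrix.trace, Matrix.diag, translationProjector_apply, ← Finset.mul_sum,
    ← Nat.cast_sum]
  exact mul_ne_zero (inv_ne_zero (Nat.cast_ne_zero.2 (NeZero.ne L)))
    (Nat.cast_ne_zero.2 hcount.ne')

theorem exists_translationMMIS_glueConfig_eq (hd : 1 ≤ d) (A : Finset (ZMod L)) :
    ∃ c : ℂ, c ≠ 0 ∧ ∀ x y, translationMMIS L d (glueConfig A x.1 y.1) (glueConfig A x.2 y.2) =
      c * ((∑ n, (ringSplitting d A).unitBlock n) x y : ℝ) := by
  have hnorm : √((Fintype.card (Fin d) : ℝ) ^ Fintype.card (ZMod L)) ≠ 0 := by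
    rw [Fintype.card_fin]
    positivity
  refine ⟨(translationProjector L d).trace⁻¹ * (L : ℂ)⁻¹ *
    (√((Fintype.card (Fin d) : ℝ) ^ Fintype.card (ZMod L)) : ℝ), ?_, fun x y => ?_⟩
  · exact mul_ne_zero (mul_ne_zero (inv_ne_zero (trace_translationProjector_ne_zero hd))
      (inv_ne_zero (Nat.cast_ne_zero.2 (NeZero.ne L)))) (Complex.ofReal_ne_zero.2 hnorm)
  · have hcount : (∑ n, (ringSplitting d A).unitBlock n) x y =
        (√((Fintype.card (Fin d) : ℝ) ^ Fintype.card (ZMod L)))⁻¹ *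
          (Finset.univ.filter fun n : ZMod L =>
            ∀ i, glueConfig A x.1 y.1 (i + n) = glueConfig A x.2 y.2 i).card := by
      simp only [Matrix.sum_apply, RegionSplitting.unitBlock, Matrix.smul_apply, smul_eq_mul,
        ← Finset.mul_sum, RegionSplitting.shiftBlock, Matrix.of_apply, Finset.sum_boole]
      rfl
    rw [translationMMIS, Matrix.smul_apply, translationProjector_apply, smul_eq_mul, hcount,
      mul_assoc _ (Complex.ofReal _), ← Complex.ofReal_mul, mul_inv_cancel_left₀ hnorm, mul_assoc,
      Complex.ofReal_natCast]

theorem sum_norm_sq_eq_of_glueConfig_eq {A : Finset (ZMod L)}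
    {M : Matrix (RingConfig L d) (RingConfig L d) ℂ} {c : ℂ}
    {B : Matrix (DoubledRegionConfig d A) (({i // i ∉ A} → Fin d) × ({i // i ∉ A} → Fin d)) ℝ}
    (hM : ∀ x y, M (glueConfig A x.1 y.1) (glueConfig A x.2 y.2) = c * (B x y : ℂ)) :
    ∑ z : RingConfig L d × RingConfig L d, ‖M z.1 z.2‖ ^ 2 = ‖c‖ ^ 2 * (B * Bᵀ).trace := by
  have hnorm (x y) : ‖M (glueConfig A x.1 y.1) (glueConfig A x.2 y.2)‖ ^ 2 =
      ‖c‖ ^ 2 * (B x y * B x y) := by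
    rw [hM, norm_mul, mul_pow, Complex.norm_real, Real.norm_eq_abs, sq_abs, sq (B x y)]
  rw [← (ringSplitting d A).glueBoth.sum_comp, Fintype.sum_prod_type]
  simp only [Matrix.trace, Matrix.diag, Matrix.mul_apply, Matrix.transpose_apply, Finset.mul_sum,
    ← hnorm]
  rfl

theorem doubledReducedDensity_eq_of_glueConfig_eq {A : Finset (ZMod L)}
    {M : Matrix (RingConfig L d) (RingConfig L d) ℂ} {c : ℂ} (hc : c ≠ 0)
    {B : Matrix (DoubledRegionConfig d A) (({i // i ∉ A} → Fin d) × ({i // i ∉ A} → Fin d)) ℝ}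
    (hM : ∀ x y, M (glueConfig A x.1 y.1) (glueConfig A x.2 y.2) = c * (B x y : ℂ)) :
    doubledReducedDensity A M = ((B * Bᵀ).trace⁻¹ • (B * Bᵀ)).map Complex.ofRealHom := by
  have htrace : 0 ≤ ‖c‖ ^ 2 * (B * Bᵀ).trace := by
    rw [← sum_norm_sq_eq_of_glueConfig_eq hM]
    positivity
  have hc' : ((‖c‖ ^ 2 : ℝ) : ℂ) ≠ 0 := by simpa using hc
  have hstate (x x' : DoubledRegionConfig d A) (y) :
      doubledState M (glueConfig A x.1 y.1, glueConfig A x.2 y.2) *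
          star (doubledState M (glueConfig A x'.1 y.1, glueConfig A x'.2 y.2)) =
        (((B * Bᵀ).trace⁻¹ * (B x y * B x' y) : ℝ) : ℂ) := by
    rw [doubledState, doubledState, sum_norm_sq_eq_of_glueConfig_eq hM, hM, hM, star_div₀,
      star_mul', Complex.star_def, Complex.conj_ofReal, Complex.conj_ofReal, div_mul_div_comm,
      ← Complex.ofReal_mul, Real.mul_self_sqrt htrace, mul_mul_mul_comm, Complex.mul_conj',
      ← Complex.ofReal_pow, Complex.ofReal_mul, mul_div_mul_left _ _ hc', div_eq_inv_mul]
    push_cast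
    rfl
  ext x x'
  simp only [doubledReducedDensity, partialTraceDoubled, Matrix.of_apply, Matrix.vecMulVec_apply,
    Pi.star_apply]
  rw [← Fintype.sum_prod_type', Finset.sum_congr rfl fun y _ => hstate x x' y,
    ← Complex.ofReal_sum, ← Finset.mul_sum]
  rfl

theorem doubledReducedDensity_translationMMIS (hd : 1 ≤ d) (A : Finset (ZMod L)) :
    doubledReducedDensity A (translationMMIS L d) =
      ((ringSplitting d A).gram.trace⁻¹ • (ringSplitting d A).gram).map Complex.ofRealHom := by
  obtain ⟨c, hc, hM⟩ := exists_translationMMIS_glueConfig_eq hd A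
  exact doubledReducedDensity_eq_of_glueConfig_eq hc hM

theorem renyiOSE_translationMMIS (k : ℕ) (hd : 1 ≤ d) (A : Finset (ZMod L)) :
    renyiOSE k A (translationMMIS L d) = 1 / (1 - (k : ℝ)) * Real.log
      (((ringSplitting d A).gram ^ k).trace / (ringSplitting d A).gram.trace ^ k) := by
  rw [renyiOSE, renyiEntropy, doubledReducedDensity_translationMMIS hd, ← Matrix.map_pow,
    ← AddMonoidHom.map_trace, Complex.ofRealHom_eq_coe, Complex.ofReal_re, smul_pow,
    Matrix.trace_smul, smul_eq_mul, inv_pow, inv_mul_eq_div]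

end TranslationSymmetricState

section EntropyAsymptotics

theorem abs_log_sub_log_le {x y : ℝ} (hx : 1 ≤ x) (hy : 1 ≤ y) :
    |Real.log x - Real.log y| ≤ |x - y| := by
  wlog h : y ≤ x generalizing x y
  · rw [abs_sub_comm, abs_sub_comm x]
    exact this hy hx (le_of_not_ge h)
  have hy₀ : 0 < y := by linarith
  have hx₀ : 0 < x := by linarith
  rw [abs_of_nonneg (sub_nonneg.2 (Real.log_le_log hy₀ h)), abs_of_nonneg (sub_nonneg.2 h),
    ← Real.log_div hx₀.ne' hy₀.ne']
  refine (Real.log_le_sub_one_of_pos (div_pos hx₀ hy₀)).trans ?_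
  rw [div_sub_one hy₀.ne']
  exact div_le_self (sub_nonneg.2 h) hy

theorem abs_log_div_pow_sub_le {k : ℕ} (hk : 2 ≤ k) {ℓ T Q X : ℝ} (hℓ : 0 < ℓ) (hT : ℓ ≤ T)
    (hQ : 1 ≤ Q) (hX : 1 ≤ X) :
    |1 / (1 - (k : ℝ)) * Real.log (Q / T ^ k) -
        ((k : ℝ) / ((k : ℝ) - 1) * Real.log ℓ - 1 / ((k : ℝ) - 1) * Real.log X)| ≤
      |X - Q| + k * (T / ℓ - 1) := by
  have hk₂ : (2 : ℝ) ≤ k := by exact_mod_cast hk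
  have hT₀ : 0 < T := hℓ.trans_le hT
  have hdiff : 1 / (1 - (k : ℝ)) * Real.log (Q / T ^ k) -
      ((k : ℝ) / ((k : ℝ) - 1) * Real.log ℓ - 1 / ((k : ℝ) - 1) * Real.log X) =
        1 / ((k : ℝ) - 1) * ((Real.log X - Real.log Q) + k * Real.log (T / ℓ)) := by
    have h₁ : (k : ℝ) - 1 ≠ 0 := by linarith
    have h₂ : 1 - (k : ℝ) ≠ 0 := by linarith
    rw [Real.log_div (by positivity) (by positivity), Real.log_pow,
      Real.log_div hT₀.ne' hℓ.ne']
    field_simp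
    ring
  have hprefactor : |1 / ((k : ℝ) - 1)| ≤ 1 := by
    rw [abs_of_nonneg (one_div_nonneg.2 (by linarith)), div_le_one (by linarith)]
    linarith
  have hlogT : |k * Real.log (T / ℓ)| ≤ k * (T / ℓ - 1) := by
    rw [abs_of_nonneg (mul_nonneg (by linarith) (Real.log_nonneg ((one_le_div hℓ).2 hT)))]
    gcongr
    exact Real.log_le_sub_one_of_pos (div_pos hT₀ hℓ)
  calc _ = |1 / ((k : ℝ) - 1)| * |(Real.log X - Real.log Q) + k * Real.log (T / ℓ)| := by
        rw [hdiff, abs_mul]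
    _ ≤ |(Real.log X - Real.log Q) + k * Real.log (T / ℓ)| :=
        mul_le_of_le_one_left (abs_nonneg _) hprefactor
    _ ≤ |X - Q| + k * (T / ℓ - 1) :=
        (abs_add_le _ _).trans (add_le_add (abs_log_sub_log_le hX hQ) hlogT)

variable {L d k : ℕ}

theorem inv_pow_pow_le_rpow_neg (hd : 1 ≤ d) (hk : 2 ≤ k) (a : ℕ) :
    (((d : ℝ) ^ (2 * (k - 1)))⁻¹) ^ a ≤ (d : ℝ) ^ (-(2 * (a : ℝ))) := by
  have hd₁ : (1 : ℝ) ≤ d := by exact_mod_cast hd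
  rw [Real.rpow_neg (by positivity), Real.rpow_mul_natCast (by positivity), Real.rpow_two, inv_pow]
  gcongr
  omega

theorem overlapScale_le {a : ℕ} (hd : 1 ≤ d) (hL : 2 * a ≤ L) :
    overlapScale L d a ≤ 2 * (d : ℝ) ^ (-(a : ℝ)) := by
  have hd₁ : (1 : ℝ) ≤ d := by exact_mod_cast hd
  have hLa : (2 : ℝ) * a ≤ L := by exact_mod_cast hL
  rw [overlapScale, two_mul (_ ^ _)]
  gcongr
  · linarith [a.cast_nonneg (α := ℝ)]
  · linarith

variable [NeZero L]

theorem abs_trace_gram_pow_sub_le (hd : 2 ≤ d) (hk : 2 ≤ k) {A : Finset (ZMod L)}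
    (hA : IsRingInterval A) (hL : 2 * A.card ≤ L) :
    |(1 + ((d : ℝ) ^ (2 * (k - 1)))⁻¹) / (1 - ((d : ℝ) ^ (2 * (k - 1)))⁻¹) -
        ((ringSplitting d A).gram ^ k).trace| ≤
      4 * (L : ℝ) ^ (2 * k) * overlapScale L d A.card := by
  have hd₂ : (2 : ℝ) ≤ d := by exact_mod_cast hd
  have hL₁ : (1 : ℝ) ≤ (L : ℝ) := by exact_mod_cast NeZero.one_le
  have hLk : (L : ℝ) ≤ (L : ℝ) ^ (2 * k) := le_self_pow₀ hL₁ (by omega)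
  have hscale : (d : ℝ) ^ (-(2 * (A.card : ℝ))) ≤ overlapScale L d A.card :=
    le_add_of_nonneg_right (by positivity)
  have hpow := (inv_pow_pow_le_rpow_neg (by omega) hk A.card).trans hscale
  have htrace := abs_trace_gram_pow_sub_sum_pow_le (k := k) (by omega) hk hA hL (d := d)
  set x : ℝ := ((d : ℝ) ^ (2 * (k - 1)))⁻¹ with hx
  have hx₀ : 0 ≤ x := by positivity
  have hx₄ : x ≤ 1 / 4 := by
    rw [hx, one_div]
    gcongr
    calc (4 : ℝ) = 2 ^ 2 := by norm_num
      _ ≤ (d : ℝ) ^ 2 := by gcongr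
      _ ≤ (d : ℝ) ^ (2 * (k - 1)) := pow_le_pow_right₀ (by linarith) (by omega)
  have hX : (1 + x) / (1 - x) ≤ 2 := by
    rw [div_le_iff₀ (by linarith)]
    linarith
  have hsum : |∑ j ∈ Finset.range L, x ^ min j (min (L - j) A.card) - (1 + x) / (1 - x)| ≤
      3 * (L : ℝ) ^ (2 * k) * overlapScale L d A.card := by
    refine (abs_sum_pow_min_sub_le hx₀ (by linarith) hL).trans ?_
    gcongr
    linarith
  rw [abs_sub_comm]
  refine (abs_sub_le _ _ _).trans ((add_le_add htrace hsum).trans_eq ?_)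
  ring

theorem trace_gram_div_sub_one_le (hd : 1 ≤ d) (hk : k ≠ 0) (A : Finset (ZMod L)) :
    (ringSplitting d A).gram.trace / L - 1 ≤ (L : ℝ) ^ (2 * k) * overlapScale L d A.card := by
  have : Nonempty (Fin d) := ⟨⟨0, hd⟩⟩
  have hL₁ : (1 : ℝ) ≤ (L : ℝ) := by exact_mod_cast NeZero.one_le
  have htrace := (ringSplitting d A).trace_gram_le
  rw [inv_sqrt_card_pow, ZMod.card] at htrace
  calc (ringSplitting d A).gram.trace / L - 1 ≤ L * (d : ℝ) ^ (-((L : ℝ) / 2)) := by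
        rw [sub_le_iff_le_add, div_le_iff₀ (by linarith)]
        linarith
    _ ≤ (L : ℝ) ^ (2 * k) * overlapScale L d A.card := by
        gcongr
        · exact le_self_pow₀ hL₁ (by omega)
        · exact le_add_of_nonneg_left (by positivity)

/-- The asymptotic value `s_k(L)` of the Rényi-`k` operator-space entanglement. -/
noncomputable def asymptoticEntropy (L d k : ℕ) : ℝ :=
  (k : ℝ) / ((k : ℝ) - 1) * Real.log L -
    1 / ((k : ℝ) - 1) *
      Real.log ((1 + ((d : ℝ) ^ (2 * (k - 1)))⁻¹) / (1 - ((d : ℝ) ^ (2 * (k - 1)))⁻¹))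

theorem abs_renyiOSE_sub_asymptoticEntropy_le (hd : 2 ≤ d) (hk : 2 ≤ k) {A : Finset (ZMod L)}
    (hA : IsRingInterval A) (hL : 2 * A.card ≤ L) :
    |renyiOSE k A (translationMMIS L d) - asymptoticEntropy L d k| ≤
      (k + 4 : ℝ) * (L : ℝ) ^ (2 * k) * overlapScale L d A.card := by
  have hd₁ : 1 ≤ d := by omega
  have : Nonempty (Fin d) := ⟨⟨0, hd₁⟩⟩
  have hL₀ : (0 : ℝ) < L := by exact_mod_cast NeZero.pos L
  have hT : (L : ℝ) ≤ (ringSplitting d A).gram.trace := by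
    simpa only [ZMod.card] using (ringSplitting d A).card_le_trace_gram
  have hQ : 1 ≤ ((ringSplitting d A).gram ^ k).trace :=
    (one_le_sum_pow_min (by positivity) (NeZero.pos L) A.card).trans
      (sum_pow_le_trace_gram_pow hd₁ hk hA hL)
  have hX : 1 ≤ (1 + ((d : ℝ) ^ (2 * (k - 1)))⁻¹) / (1 - ((d : ℝ) ^ (2 * (k - 1)))⁻¹) := by
    have hx₀ : 0 ≤ ((d : ℝ) ^ (2 * (k - 1)))⁻¹ := by positivity
    have hx₁ : ((d : ℝ) ^ (2 * (k - 1)))⁻¹ < 1 :=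
      inv_lt_one_of_one_lt₀ (one_lt_pow₀ (by exact_mod_cast hd) (by omega))
    rw [one_le_div (by linarith)]
    linarith
  rw [renyiOSE_translationMMIS k hd₁ A, asymptoticEntropy]
  calc _ ≤ 4 * (L : ℝ) ^ (2 * k) * overlapScale L d A.card +
        k * ((L : ℝ) ^ (2 * k) * overlapScale L d A.card) := by
        refine (abs_log_div_pow_sub_le hk hL₀ hT hQ hX).trans (add_le_add
          (abs_trace_gram_pow_sub_le hd hk hA hL) (mul_le_mul_of_nonneg_left ?_ k.cast_nonneg))
        exact trace_gram_div_sub_one_le hd₁ (by omega) A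
    _ = (k + 4 : ℝ) * (L : ℝ) ^ (2 * k) * overlapScale L d A.card := by ring

theorem pow_mul_overlapScale_le (hd : 2 ≤ d) {c : ℝ} (hc : c < 1) {a : ℕ} (hL : 2 * a ≤ L)
    (ha : 2 * k / ((1 - c) * Real.log d) * Real.log L ≤ a) :
    (L : ℝ) ^ (2 * k) * overlapScale L d a ≤ 2 * (d : ℝ) ^ (-(c * (a : ℝ))) := by
  have hd₁ : (1 : ℝ) < d := by exact_mod_cast hd
  have hd₀ : (0 : ℝ) < d := by linarith
  have hL₀ : (0 : ℝ) < L := by exact_mod_cast NeZero.pos L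
  have hpow : (L : ℝ) ^ (2 * k) ≤ (d : ℝ) ^ ((1 - c) * (a : ℝ)) := by
    rw [← Real.log_le_log_iff (by positivity) (by positivity), Real.log_pow, Real.log_rpow hd₀]
    rw [div_mul_eq_mul_div, div_le_iff₀ (mul_pos (by linarith) (Real.log_pos hd₁))] at ha
    push_cast
    linarith
  calc (L : ℝ) ^ (2 * k) * overlapScale L d a
      ≤ (d : ℝ) ^ ((1 - c) * (a : ℝ)) * (2 * (d : ℝ) ^ (-(a : ℝ))) :=
        mul_le_mul hpow (overlapScale_le (by omega) hL) (by rw [overlapScale]; positivity)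
          (by positivity)
    _ = 2 * (d : ℝ) ^ (-(c * (a : ℝ))) := by
        rw [mul_left_comm, ← Real.rpow_add hd₀]
        congr 2
        ring

end EntropyAsymptotics

theorem mainTheorem9 (d k : ℕ) (hd : 2 ≤ d) (hk : 2 ≤ k) :
    (∃ C : ℝ, ∀ (L : ℕ) [NeZero L] (A : Finset (ZMod L)),
      IsRingInterval A → 2 * A.card ≤ L →
      |renyiOSE k A (translationMMIS L d) -
          ((k : ℝ) / ((k : ℝ) - 1) * Real.log L -
            1 / ((k : ℝ) - 1) *
              Real.log ((1 + ((d : ℝ) ^ (2 * (k - 1)))⁻¹) / (1 - ((d : ℝ) ^ (2 * (k - 1)))⁻¹)))|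
        ≤ C * (L : ℝ) ^ (2 * k) *
            ((d : ℝ) ^ (-(2 * (A.card : ℝ))) + (d : ℝ) ^ (-((L : ℝ) / 2)))) ∧
    (∀ c : ℝ, c < 1 → ∃ K C : ℝ, ∀ (L : ℕ) [NeZero L] (A : Finset (ZMod L)),
      IsRingInterval A → K * Real.log L ≤ (A.card : ℝ) → 2 * A.card ≤ L →
      |renyiOSE k A (translationMMIS L d) -
          ((k : ℝ) / ((k : ℝ) - 1) * Real.log L -
            1 / ((k : ℝ) - 1) *
              Real.log ((1 + ((d : ℝ) ^ (2 * (k - 1)))⁻¹) / (1 - ((d : ℝ) ^ (2 * (k - 1)))⁻¹)))|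
        ≤ C * (d : ℝ) ^ (-(c * (A.card : ℝ)))) := by
  refine ⟨⟨k + 4, fun L _ A hA hL => abs_renyiOSE_sub_asymptoticEntropy_le hd hk hA hL⟩, fun c hc =>
    ⟨2 * k / ((1 - c) * Real.log d), (k + 4) * 2, fun L _ A hA hK hL => ?_⟩⟩
  refine (abs_renyiOSE_sub_asymptoticEntropy_le hd hk hA hL).trans ?_
  rw [mul_assoc, mul_assoc]
  exact mul_le_mul_of_nonneg_left (pow_mul_overlapScale_le hd hc hL hK) (by positivity)
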